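/- Let $\Sigma$ be a symmetric monoidal signature, i.e. a set of generators $o : k\to l$ with arity $k$ and coarity $l$ ($k,l\in\mathbb N$). Let $\mathbf S_\Sigma$ be the PROP (symmetric strict monoidal category with objects the natural numbers and $\oplus$ on objects being addition) freely generated by $\Sigma$: its arrows $n\to m$ are the $\Sigma$-terms $n\to m$ modulo the laws of symmetric strict monoidal categories. A $\Sigma$-hypergraph $G$ consists of a finite set of nodes and, for all $k,l\in\mathbb N$, a finite set of hyperedges with $k$ ordered source nodes and $l$ ordered target nodes, each labelled by a generator $k\to l$ of $\Sigma$. Let $\mathbf{FTerm}_\Sigma$ be the PROP whose arrows $n\to m$ are the isomorphism classes of cospans $n\xrightarrow{f}G\xleftarrow{g}m$ of $\Sigma$-hypergraphs, where $n,m$ are regarded as discrete hypergraphs (so that $f,g$ are functions from $\{0,\dots,n-1\}$ and $\{0,\dots,m-1\}$ to the nodes of $G$); composition is by pushout, and $\oplus$ is disjoint union. Let $[\![\cdot]\!]:\mathbf S_\Sigma\to\mathbf{FTerm}_\Sigma$ be the unique morphism of PROPs (identity-on-objects strict symmetric monoidal functor) that sends each generator $o:n\to m$ to the cospan $n\to G_o\leftarrow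 m$, where $G_o$ has $n+m$ distinct nodes and one hyperedge, labelled $o$, whose sources are, in order, the images of $0,\dots,n-1$ under the left leg and whose targets are, in order, the images of $0,\dots,m-1$ under the right leg. A cospan $n\xrightarrow{f}G\xleftarrow{g}m$ is *monogamous* if $f$ and $g$ are injective and, for every node $v$ of $G$, the number of pairs $(h,i)$ such that $v$ is the $i$-th target of the hyperedge $h$ is $0$ if $v$ is in the image of $f$ and $1$ otherwise, and the number of pairs $(h,j)$ such that $v$ is the $j$-th source of $h$ is $0$ if $v$ is in the image of $g$ and $1$ otherwise. It is *directed acyclic* if there is no directed path in $G$ from a node $v$ to itself, i.e. no nonempty sequence of hyperedges $h_1,\dots,h_r$ such that $v$ is a source of $h_1$ and a target of $h_r$ and, for each $i<r$, some target of $h_i$ is a source of $h_{i+1}$. **Theorem.** A cospan $n\to G\leftarrow m$ in $\mathbf{FTerm}_\Sigma$ is in the image of $[\![\cdot]\!]$ if and only if it is monogamous and directed acyclic. -/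

import Mathlib

universe u w

namespace FrobTerm

/-! ## PROPs -/

/-- Transport of an arrow along equalities of its source and target. -/
def castHom {H : ℕ → ℕ → Type w} {a b a' b' : ℕ} (ha : a = a') (hb : b = b') (f : H a b) :
    H a' b' := hb ▸ ha ▸ f

/-- A PROP: a symmetric strict monoidal category whose objects are the natural numbers and whose
monoidal product on objects is addition. Composition is written in diagrammatic order. -/
structure PROP where
  Hom : ℕ → ℕ → Type w
  id : ∀ n, Hom n n
  comp : ∀ {a b c}, Hom a b → Hom b c → Hom a c
  tensor : ∀ {a b a' b'}, Hom a b → Hom a' b' → Hom (a + a') (b + b')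
  symm : ∀ a b, Hom (a + b) (b + a)
  comp_assoc : ∀ {a b c d} (f : Hom a b) (g : Hom b c) (h : Hom c d),
    comp (comp f g) h = comp f (comp g h)
  id_comp : ∀ {a b} (f : Hom a b), comp (id a) f = f
  comp_id : ∀ {a b} (f : Hom a b), comp f (id b) = f
  tensor_assoc : ∀ {a b a' b' a'' b''} (f : Hom a b) (g : Hom a' b') (h : Hom a'' b''),
    castHom (Nat.add_assoc a a' a'') (Nat.add_assoc b b' b'') (tensor (tensor f g) h) =
      tensor f (tensor g h)
  id_zero_tensor : ∀ {a b} (f : Hom a b),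
    castHom (Nat.zero_add a) (Nat.zero_add b) (tensor (id 0) f) = f
  tensor_id_zero : ∀ {a b} (f : Hom a b),
    castHom (Nat.add_zero a) (Nat.add_zero b) (tensor f (id 0)) = f
  tensor_id : ∀ a b, tensor (id a) (id b) = id (a + b)
  interchange : ∀ {a b c a' b' c'} (f : Hom a b) (g : Hom b c) (f' : Hom a' b') (g' : Hom b' c'),
    tensor (comp f g) (comp f' g') = comp (tensor f f') (tensor g g')
  symm_symm : ∀ a b, comp (symm a b) (symm b a) = id (a + b)
  symm_natural : ∀ {n m} (z : ℕ) (f : Hom n m),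
    comp (tensor f (id z)) (symm m z) = comp (symm n z) (tensor (id z) f)
  hexagon : ∀ a b c, symm a (b + c) =
    comp (castHom (Nat.add_assoc a b c) rfl (tensor (symm a b) (id c)))
      (castHom (Nat.add_assoc b a c).symm (Nat.add_assoc b c a).symm (tensor (id b) (symm a c)))

/-- A morphism of PROPs: an identity-on-objects strict symmetric monoidal functor. -/
structure PROPHom (P : PROP.{u}) (Q : PROP.{w}) where
  map : ∀ {n m}, P.Hom n m → Q.Hom n m
  map_id : ∀ n, map (P.id n) = Q.id n
  map_comp : ∀ {a b c} (f : P.Hom a b) (g : P.Hom b c),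
    map (P.comp f g) = Q.comp (map f) (map g)
  map_tensor : ∀ {a b a' b'} (f : P.Hom a b) (g : P.Hom a' b'),
    map (P.tensor f g) = Q.tensor (map f) (map g)
  map_symm : ∀ a b, map (P.symm a b) = Q.symm a b

/-! ## The PROP freely generated by a signature -/

/-- A (one-sorted) symmetric monoidal signature: `Sig n m` is the set of generators of arity `n`
and coarity `m`. -/
abbrev Signature := ℕ → ℕ → Type u

/-- Terms over a signature. -/
inductive Term (Sig : Signature.{u}) : ℕ → ℕ → Type u
  | gen {n m : ℕ} (o : Sig n m) : Term Sig n m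
  | id (n : ℕ) : Term Sig n n
  | symm (a b : ℕ) : Term Sig (a + b) (b + a)
  | comp {a b c : ℕ} (f : Term Sig a b) (g : Term Sig b c) : Term Sig a c
  | tensor {a b a' b' : ℕ} (f : Term Sig a b) (g : Term Sig a' b') : Term Sig (a + a') (b + b')

/-- The smallest congruence on terms that contains the laws of symmetric strict monoidal
categories. -/
inductive Term.Rel {Sig : Signature.{u}} : ∀ {n m : ℕ}, Term Sig n m → Term Sig n m → Prop
  | refl {n m} (t : Term Sig n m) : Rel t t
  | swap {n m} {s t : Term Sig n m} : Rel s t → Rel t s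
  | trans {n m} {s t r : Term Sig n m} : Rel s t → Rel t r → Rel s r
  | comp_congr {a b c} {s s' : Term Sig a b} {t t' : Term Sig b c} :
      Rel s s' → Rel t t' → Rel (s.comp t) (s'.comp t')
  | tensor_congr {a b a' b'} {s s' : Term Sig a b} {t t' : Term Sig a' b'} :
      Rel s s' → Rel t t' → Rel (s.tensor t) (s'.tensor t')
  | comp_assoc {a b c d} (f : Term Sig a b) (g : Term Sig b c) (h : Term Sig c d) :
      Rel ((f.comp g).comp h) (f.comp (g.comp h))
  | id_comp {a b} (f : Term Sig a b) : Rel ((Term.id a).comp f) f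
  | comp_id {a b} (f : Term Sig a b) : Rel (f.comp (Term.id b)) f
  | tensor_assoc {a b a' b' a'' b''} (f : Term Sig a b) (g : Term Sig a' b')
      (h : Term Sig a'' b'') :
      Rel (castHom (Nat.add_assoc a a' a'') (Nat.add_assoc b b' b'') ((f.tensor g).tensor h))
        (f.tensor (g.tensor h))
  | id_zero_tensor {a b} (f : Term Sig a b) :
      Rel (castHom (Nat.zero_add a) (Nat.zero_add b) ((Term.id 0).tensor f)) f
  | tensor_id_zero {a b} (f : Term Sig a b) :
      Rel (castHom (Nat.add_zero a) (Nat.add_zero b) (f.tensor (Term.id 0))) f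
  | tensor_id (a b : ℕ) : Rel ((Term.id a).tensor (Term.id b)) (Term.id (a + b))
  | interchange {a b c a' b' c'} (f : Term Sig a b) (g : Term Sig b c) (f' : Term Sig a' b')
      (g' : Term Sig b' c') :
      Rel ((f.comp g).tensor (f'.comp g')) ((f.tensor f').comp (g.tensor g'))
  | symm_symm (a b : ℕ) : Rel ((Term.symm a b).comp (Term.symm b a)) (Term.id (a + b))
  | symm_natural {n m} (z : ℕ) (f : Term Sig n m) :
      Rel ((f.tensor (Term.id z)).comp (Term.symm m z))
        ((Term.symm n z).comp ((Term.id z).tensor f))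
  | hexagon (a b c : ℕ) :
      Rel (Term.symm a (b + c))
        (Term.comp
          (castHom (Nat.add_assoc a b c) rfl ((Term.symm a b).tensor (Term.id c)))
          (castHom (Nat.add_assoc b a c).symm (Nat.add_assoc b c a).symm
            ((Term.id b).tensor (Term.symm a c))))

theorem castHom_quot {Sig : Signature.{u}} {a b a' b' : ℕ} (ha : a = a') (hb : b = b')
    (t : Term Sig a b) :
    castHom (H := fun n m => Quot (Term.Rel (Sig := Sig) (n := n) (m := m))) ha hb
      (Quot.mk _ t) = Quot.mk _ (castHom ha hb t) := by
  subst ha hb; rfl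

/-- The PROP freely generated by a signature (and no equations): terms modulo the laws of
symmetric strict monoidal categories. -/
def freePROP (Sig : Signature.{u}) : PROP.{u} where
  Hom n m := Quot (Term.Rel (Sig := Sig) (n := n) (m := m))
  id n := Quot.mk _ (Term.id n)
  comp := Quot.map₂ Term.comp (fun _ _ _ h => .comp_congr (.refl _) h)
    (fun _ _ _ h => .comp_congr h (.refl _))
  tensor := Quot.map₂ Term.tensor (fun _ _ _ h => .tensor_congr (.refl _) h)
    (fun _ _ _ h => .tensor_congr h (.refl _))
  symm a b := Quot.mk _ (Term.symm a b)
  comp_assoc := by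
    rintro _ _ _ _ ⟨f⟩ ⟨g⟩ ⟨h⟩; exact Quot.sound (.comp_assoc f g h)
  id_comp := by rintro _ _ ⟨f⟩; exact Quot.sound (.id_comp f)
  comp_id := by rintro _ _ ⟨f⟩; exact Quot.sound (.comp_id f)
  tensor_assoc := by
    rintro _ _ _ _ _ _ ⟨f⟩ ⟨g⟩ ⟨h⟩
    exact (castHom_quot _ _ _).trans (Quot.sound (.tensor_assoc f g h))
  id_zero_tensor := by
    rintro _ _ ⟨f⟩; exact (castHom_quot _ _ _).trans (Quot.sound (.id_zero_tensor f))
  tensor_id_zero := by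
    rintro _ _ ⟨f⟩; exact (castHom_quot _ _ _).trans (Quot.sound (.tensor_id_zero f))
  tensor_id a b := Quot.sound (.tensor_id a b)
  interchange := by
    rintro _ _ _ _ _ _ ⟨f⟩ ⟨g⟩ ⟨f'⟩ ⟨g'⟩; exact Quot.sound (.interchange f g f' g')
  symm_symm a b := Quot.sound (.symm_symm a b)
  symm_natural := by rintro _ _ z ⟨f⟩; exact Quot.sound (.symm_natural z f)
  hexagon a b c := by
    erw [castHom_quot, castHom_quot]; exact Quot.sound (.hexagon a b c)

/-- Interpretation of terms in a PROP, given an interpretation of the generators. -/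
def Term.eval {Sig : Signature.{u}} (P : PROP.{w}) (φ : ∀ {n m}, Sig n m → P.Hom n m) :
    ∀ {n m : ℕ}, Term Sig n m → P.Hom n m
  | _, _, .gen o => φ o
  | _, _, .id n => P.id n
  | _, _, .symm a b => P.symm a b
  | _, _, .comp f g => P.comp (f.eval P φ) (g.eval P φ)
  | _, _, .tensor f g => P.tensor (f.eval P φ) (g.eval P φ)

theorem Term.eval_castHom {Sig : Signature.{u}} (P : PROP.{w})
    (φ : ∀ {n m}, Sig n m → P.Hom n m) {a b a' b' : ℕ} (ha : a = a') (hb : b = b')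
    (t : Term Sig a b) :
    (castHom ha hb t : Term Sig a' b').eval P φ = castHom ha hb (t.eval P φ) := by
  subst ha hb; rfl

theorem Term.eval_rel {Sig : Signature.{u}} (P : PROP.{w})
    (φ : ∀ {n m}, Sig n m → P.Hom n m) {n m : ℕ} {s t : Term Sig n m} (h : Term.Rel s t) :
    s.eval P φ = t.eval P φ := by
  induction h with
  | refl => rfl
  | swap _ ih => exact ih.symm
  | trans _ _ ih ih' => exact ih.trans ih'
  | comp_congr _ _ ih ih' => simp only [Term.eval, ih, ih']
  | tensor_congr _ _ ih ih' => simp only [Term.eval, ih, ih']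
  | comp_assoc => exact P.comp_assoc _ _ _
  | id_comp => exact P.id_comp _
  | comp_id => exact P.comp_id _
  | tensor_assoc => rw [Term.eval_castHom]; exact P.tensor_assoc _ _ _
  | id_zero_tensor => rw [Term.eval_castHom]; exact P.id_zero_tensor _
  | tensor_id_zero => rw [Term.eval_castHom]; exact P.tensor_id_zero _
  | tensor_id => exact P.tensor_id _ _
  | interchange => exact P.interchange _ _ _ _
  | symm_symm => exact P.symm_symm _ _
  | symm_natural => exact P.symm_natural _ _
  | hexagon => simp only [Term.eval, Term.eval_castHom]; exact P.hexagon _ _ _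

/-- The PROP morphism out of the free PROP that is determined by its values on the generators. -/
def freePROP.lift {Sig : Signature.{u}} (P : PROP.{w}) (φ : ∀ {n m}, Sig n m → P.Hom n m) :
    PROPHom (freePROP Sig) P where
  map := Quot.lift (Term.eval P φ) (fun _ _ h => Term.eval_rel P φ h)
  map_id _ := rfl
  map_comp := by rintro _ _ _ ⟨f⟩ ⟨g⟩; rfl
  map_tensor := by rintro _ _ _ _ ⟨f⟩ ⟨g⟩; rfl
  map_symm _ _ := rfl

/-! ## Hypergraphs -/

/-- A finite directed hypergraph typed by `Sig`: a finite set of nodes and, for all `k` and `l`,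
a finite set of hyperedges with `k` ordered sources and `l` ordered targets, each labelled by a
generator of arity `k` and coarity `l`. (Regarding `Sig` as a hypergraph with a single node, the
labelling is exactly a hypergraph morphism to `Sig`.) -/
structure Hypergraph (Sig : Signature.{u}) where
  Node : Type
  Edge : ℕ → ℕ → Type
  src : ∀ {k l}, Edge k l → Fin k → Node
  tgt : ∀ {k l}, Edge k l → Fin l → Node
  label : ∀ {k l}, Edge k l → Sig k l
  node_finite : Finite Node
  edge_finite : ∀ k l, Finite (Edge k l)

namespace Hypergraph

variable {Sig : Signature.{u}} (G : Hypergraph Sig)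

/-- All hyperedges of a hypergraph. -/
abbrev AnyEdge : Type := Σ k : ℕ, Σ l : ℕ, G.Edge k l

/-- The number of pairs `(h, i)` such that `v` is the `i`-th target of the hyperedge `h`. -/
noncomputable def indegree (v : G.Node) : ℕ∞ :=
  ENat.card {p : Σ h : G.AnyEdge, Fin h.2.1 // G.tgt p.1.2.2 p.2 = v}

/-- The number of pairs `(h, j)` such that `v` is the `j`-th source of the hyperedge `h`. -/
noncomputable def outdegree (v : G.Node) : ℕ∞ :=
  ENat.card {p : Σ h : G.AnyEdge, Fin h.1 // G.src p.1.2.2 p.2 = v}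

/-- `v` is one of the sources of the hyperedge `h`. -/
def IsSource (v : G.Node) (h : G.AnyEdge) : Prop := ∃ j, G.src h.2.2 j = v

/-- `v` is one of the targets of the hyperedge `h`. -/
def IsTarget (v : G.Node) (h : G.AnyEdge) : Prop := ∃ i, G.tgt h.2.2 i = v

/-- `h'` is a successor of `h`: some target of `h` is a source of `h'`. -/
def IsSuccessor (h h' : G.AnyEdge) : Prop := ∃ v, G.IsTarget v h ∧ G.IsSource v h'

/-- The list `p` of hyperedges is a directed path from the node `v` to the node `v'`: it is
nonempty, each hyperedge in it is followed by a successor, `v` is a source of the first hyperedge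
and `v'` is a target of the last one. -/
def IsPath (v : G.Node) (p : List G.AnyEdge) (v' : G.Node) : Prop :=
  p.IsChain G.IsSuccessor ∧ (∃ h ∈ p.head?, G.IsSource v h) ∧ (∃ h ∈ p.getLast?, G.IsTarget v' h)

/-- There is no directed path from a node to itself. -/
def DirectedAcyclic : Prop := ∀ (v : G.Node) (p : List G.AnyEdge), ¬ G.IsPath v p v

end Hypergraph

/-! ## Discrete cospans of hypergraphs -/

/-- A cospan `n → G ← m` of hypergraphs typed by `Sig`, where `n` and `m` are regarded as discrete
hypergraphs (so that the legs are just functions into the nodes of `G`). -/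
structure Cospan (Sig : Signature.{u}) (n m : ℕ) extends Hypergraph Sig where
  inp : Fin n → Node
  out : Fin m → Node

namespace Cospan

variable {Sig : Signature.{u}}

/-- `n → G ← m` is monogamous. -/
def Monogamous {n m : ℕ} (G : Cospan Sig n m) : Prop :=
  Function.Injective G.inp ∧ Function.Injective G.out ∧
  ∀ v : G.Node,
    (v ∈ Set.range G.inp → G.indegree v = 0) ∧ (v ∉ Set.range G.inp → G.indegree v = 1) ∧
    (v ∈ Set.range G.out → G.outdegree v = 0) ∧ (v ∉ Set.range G.out → G.outdegree v = 1)

/-- Isomorphisms of cospans `n → G ← m` and `n → H ← m`. -/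
structure Iso {n m : ℕ} (G H : Cospan Sig n m) where
  node : G.Node ≃ H.Node
  edge : ∀ k l, G.Edge k l ≃ H.Edge k l
  src : ∀ {k l} (e : G.Edge k l) (i : Fin k), H.src (edge k l e) i = node (G.src e i)
  tgt : ∀ {k l} (e : G.Edge k l) (i : Fin l), H.tgt (edge k l e) i = node (G.tgt e i)
  label : ∀ {k l} (e : G.Edge k l), H.label (edge k l e) = G.label e
  inp : ∀ i, H.inp i = node (G.inp i)
  out : ∀ i, H.out i = node (G.out i)

def Iso.refl {n m : ℕ} (G : Cospan Sig n m) : Iso G G :=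
  ⟨Equiv.refl _, fun _ _ => Equiv.refl _, fun _ _ => rfl, fun _ _ => rfl, fun _ => rfl,
    fun _ => rfl, fun _ => rfl⟩

def Iso.symm {n m : ℕ} {G H : Cospan Sig n m} (f : Iso G H) : Iso H G where
  node := f.node.symm
  edge k l := (f.edge k l).symm
  src e i := by
    rw [Equiv.eq_symm_apply, ← f.src, Equiv.apply_symm_apply]
  tgt e i := by
    rw [Equiv.eq_symm_apply, ← f.tgt, Equiv.apply_symm_apply]
  label e := by rw [← f.label, Equiv.apply_symm_apply]
  inp i := by rw [Equiv.eq_symm_apply, ← f.inp]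
  out i := by rw [Equiv.eq_symm_apply, ← f.out]

def Iso.trans {n m : ℕ} {G H K : Cospan Sig n m} (f : Iso G H) (g : Iso H K) : Iso G K where
  node := f.node.trans g.node
  edge k l := (f.edge k l).trans (g.edge k l)
  src e i := by simp [g.src, f.src]
  tgt e i := by simp [g.tgt, f.tgt]
  label e := by simp [g.label, f.label]
  inp i := by simp [g.inp, f.inp]
  out i := by simp [g.out, f.out]

instance setoid (Sig : Signature.{u}) (n m : ℕ) : Setoid (Cospan Sig n m) where
  r G H := Nonempty (Iso G H)
  iseqv := ⟨fun G => ⟨Iso.refl G⟩, fun ⟨f⟩ => ⟨f.symm⟩, fun ⟨f⟩ ⟨g⟩ => ⟨f.trans g⟩⟩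

/-- The discrete cospan `n → n ← m` with left leg the identity and right leg `e`. -/
def wiring {n m : ℕ} (e : Fin m → Fin n) : Cospan Sig n m where
  Node := Fin n
  Edge _ _ := Empty
  src := Empty.elim
  tgt := Empty.elim
  label := Empty.elim
  node_finite := inferInstance
  edge_finite _ _ := inferInstance
  inp := _root_.id
  out := e

/-- The identity cospan `n → n ← n`. -/
def id (Sig : Signature.{u}) (n : ℕ) : Cospan Sig n n := wiring _root_.id

/-- The block swap: its `i`-th output is the input `a + i` if `i < b`, and the input `i - b`
otherwise. -/
def swapFun (a b : ℕ) : Fin (b + a) → Fin (a + b) := Fin.append (Fin.natAdd a) (Fin.castAdd b)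

/-- The symmetry cospan `a + b → a + b ← b + a`. -/
def symm (Sig : Signature.{u}) (a b : ℕ) : Cospan Sig (a + b) (b + a) := wiring (swapFun a b)

/-- The nodes that the composite of two cospans identifies. -/
inductive Glue {a b c : ℕ} (G : Cospan Sig a b) (H : Cospan Sig b c) :
    G.Node ⊕ H.Node → G.Node ⊕ H.Node → Prop
  | glue (i : Fin b) : Glue G H (.inl (G.out i)) (.inr (H.inp i))

/-- Composition of cospans `a → G ← b` and `b → H ← c`, by the pushout of `G ← b → H`: the
disjoint union of `G` and `H`, in which for all `i < b` the `i`-th output of `G` is identified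
with the `i`-th input of `H`. -/
def comp {a b c : ℕ} (G : Cospan Sig a b) (H : Cospan Sig b c) : Cospan Sig a c where
  Node := Quot (Glue G H)
  Edge k l := G.Edge k l ⊕ H.Edge k l
  src := Sum.elim (fun e i => Quot.mk _ (.inl (G.src e i))) (fun e i => Quot.mk _ (.inr (H.src e i)))
  tgt := Sum.elim (fun e i => Quot.mk _ (.inl (G.tgt e i))) (fun e i => Quot.mk _ (.inr (H.tgt e i)))
  label := Sum.elim G.label H.label
  node_finite := by have := G.node_finite; have := H.node_finite; infer_instance
  edge_finite k l := by have := G.edge_finite k l; have := H.edge_finite k l; infer_instance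
  inp i := Quot.mk _ (.inl (G.inp i))
  out i := Quot.mk _ (.inr (H.out i))

/-- The monoidal product of cospans: disjoint union. -/
def tensor {a b a' b' : ℕ} (G : Cospan Sig a b) (H : Cospan Sig a' b') :
    Cospan Sig (a + a') (b + b') where
  Node := G.Node ⊕ H.Node
  Edge k l := G.Edge k l ⊕ H.Edge k l
  src := Sum.elim (fun e i => .inl (G.src e i)) (fun e i => .inr (H.src e i))
  tgt := Sum.elim (fun e i => .inl (G.tgt e i)) (fun e i => .inr (H.tgt e i))
  label := Sum.elim G.label H.label
  node_finite := by have := G.node_finite; have := H.node_finite; infer_instance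
  edge_finite k l := by have := G.edge_finite k l; have := H.edge_finite k l; infer_instance
  inp := Fin.append (fun i => .inl (G.inp i)) (fun i => .inr (H.inp i))
  out := Fin.append (fun i => .inl (G.out i)) (fun i => .inr (H.out i))

/-- The cospan `n → G ← m` of a generator `o : n → m`: `G` has `n + m` distinct nodes and a single
hyperedge, labelled `o`, whose sources are the first `n` nodes (the inputs, in order) and whose
targets are the last `m` nodes (the outputs, in order). -/
def gen {n m : ℕ} (o : Sig n m) : Cospan Sig n m where
  Node := Fin n ⊕ Fin m
  Edge k l := {_e : Unit // k = n ∧ l = m}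
  src e i := .inl (Fin.cast e.2.1 i)
  tgt e i := .inr (Fin.cast e.2.2 i)
  label e := castHom e.2.1.symm e.2.2.symm o
  node_finite := inferInstance
  edge_finite _ _ := inferInstance
  inp := .inl
  out := .inr

/-! Auxiliary isomorphisms for the laws of a PROP. -/

def compCongr {a b c : ℕ} {G G' : Cospan Sig a b} {H H' : Cospan Sig b c}
    (f : Iso G G') (g : Iso H H') : Iso (G.comp H) (G'.comp H') where
  node :=
    { toFun := Quot.map (Sum.map f.node g.node) (by
        rintro _ _ ⟨i⟩; simp only [Sum.map_inl, Sum.map_inr, ← f.out, ← g.inp]; exact .glue i)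
      invFun := Quot.map (Sum.map f.node.symm g.node.symm) (by
        rintro _ _ ⟨i⟩
        simp only [Sum.map_inl, Sum.map_inr, f.out, g.inp, Equiv.symm_apply_apply]; exact .glue i)
      left_inv := by
        rintro ⟨x | x⟩
        exacts [congrArg (fun x => Quot.mk (Glue G H) (Sum.inl x)) (f.node.symm_apply_apply x),
          congrArg (fun x => Quot.mk (Glue G H) (Sum.inr x)) (g.node.symm_apply_apply x)]
      right_inv := by
        rintro ⟨x | x⟩
        exacts [congrArg (fun x => Quot.mk (Glue G' H') (Sum.inl x)) (f.node.apply_symm_apply x),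
          congrArg (fun x => Quot.mk (Glue G' H') (Sum.inr x)) (g.node.apply_symm_apply x)] }
  edge k l := Equiv.sumCongr (f.edge k l) (g.edge k l)
  src := by
    rintro _ _ (e | e) i
    exacts [congrArg (fun x => Quot.mk (Glue G' H') (Sum.inl x)) (f.src e i),
      congrArg (fun x => Quot.mk (Glue G' H') (Sum.inr x)) (g.src e i)]
  tgt := by
    rintro _ _ (e | e) i
    exacts [congrArg (fun x => Quot.mk (Glue G' H') (Sum.inl x)) (f.tgt e i),
      congrArg (fun x => Quot.mk (Glue G' H') (Sum.inr x)) (g.tgt e i)]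
  label := by rintro _ _ (e | e); exacts [f.label e, g.label e]
  inp i := congrArg (fun x => Quot.mk (Glue G' H') (Sum.inl x)) (f.inp i)
  out i := congrArg (fun x => Quot.mk (Glue G' H') (Sum.inr x)) (g.out i)

def tensorCongr {a b a' b' : ℕ} {G G' : Cospan Sig a b} {H H' : Cospan Sig a' b'}
    (f : Iso G G') (g : Iso H H') : Iso (G.tensor H) (G'.tensor H') where
  node := Equiv.sumCongr f.node g.node
  edge k l := Equiv.sumCongr (f.edge k l) (g.edge k l)
  src := by
    rintro _ _ (e | e) i
    exacts [congrArg Sum.inl (f.src e i), congrArg Sum.inr (g.src e i)]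
  tgt := by
    rintro _ _ (e | e) i
    exacts [congrArg Sum.inl (f.tgt e i), congrArg Sum.inr (g.tgt e i)]
  label := by rintro _ _ (e | e); exacts [f.label e, g.label e]
  inp i := by induction i using Fin.addCases <;> simp [tensor, f.inp, g.inp] <;> rfl
  out i := by induction i using Fin.addCases <;> simp [tensor, f.out, g.out] <;> rfl

/-- Precomposition of the legs of a cospan with functions. -/
def relabel {n m n' m' : ℕ} (G : Cospan Sig n m) (f : Fin n' → Fin n) (g : Fin m' → Fin m) :
    Cospan Sig n' m' where
  toHypergraph := G.toHypergraph
  inp i := G.inp (f i)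
  out i := G.out (g i)

def compAssoc {a b c d : ℕ} (G : Cospan Sig a b) (H : Cospan Sig b c) (K : Cospan Sig c d) :
    Iso ((G.comp H).comp K) (G.comp (H.comp K)) where
  node :=
    { toFun := Quot.lift
        (Sum.elim
          (Quot.lift (Sum.elim (fun x => Quot.mk _ (.inl x))
            (fun x => Quot.mk _ (.inr (Quot.mk _ (.inl x)))))
            (by rintro _ _ ⟨i⟩; exact Quot.sound (.glue (G := G) (H := H.comp K) i)))
          (fun x => Quot.mk _ (.inr (Quot.mk _ (.inr x)))))
        (by
          rintro _ _ ⟨i⟩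
          exact congrArg (fun x => Quot.mk (Glue G (H.comp K)) (.inr x))
            (Quot.sound (.glue (G := H) (H := K) i)))
      invFun := Quot.lift
        (Sum.elim (fun x => Quot.mk _ (.inl (Quot.mk _ (.inl x))))
          (Quot.lift (Sum.elim (fun x => Quot.mk _ (.inl (Quot.mk _ (.inr x))))
            (fun x => Quot.mk _ (.inr x)))
            (by rintro _ _ ⟨i⟩; exact Quot.sound (.glue (G := G.comp H) (H := K) i))))
        (by
          rintro _ _ ⟨i⟩
          exact congrArg (fun x => Quot.mk (Glue (G.comp H) K) (.inl x))
            (Quot.sound (.glue (G := G) (H := H) i)))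
      left_inv := by
        rintro ⟨x | x⟩
        · obtain ⟨x | x⟩ := x <;> rfl
        · rfl
      right_inv := by
        rintro ⟨x | x⟩
        · rfl
        · obtain ⟨x | x⟩ := x <;> rfl }
  edge k l := Equiv.sumAssoc _ _ _
  src := by rintro _ _ ((e | e) | e) i <;> rfl
  tgt := by rintro _ _ ((e | e) | e) i <;> rfl
  label := by rintro _ _ ((e | e) | e) <;> rfl
  inp i := rfl
  out i := rfl

def compWiring {a b c : ℕ} (G : Cospan Sig a b) (e : Fin c → Fin b) :
    Iso (G.comp (wiring e)) (G.relabel _root_.id e) where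
  node :=
    { toFun := Quot.lift (Sum.elim _root_.id G.out) (by rintro _ _ ⟨i⟩; rfl)
      invFun x := Quot.mk _ (.inl x)
      left_inv := by
        rintro ⟨x | x⟩
        · rfl
        · exact Quot.sound (.glue (G := G) (H := wiring e) x)
      right_inv _ := rfl }
  edge k l := Equiv.sumEmpty _ Empty
  src := by rintro _ _ (e | e) i; exacts [rfl, e.elim]
  tgt := by rintro _ _ (e | e) i; exacts [rfl, e.elim]
  label := by rintro _ _ (e | e); exacts [rfl, e.elim]
  inp i := rfl
  out i := rfl

def wiringComp {a b c : ℕ} (e : Fin b ≃ Fin a) (G : Cospan Sig b c) :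
    Iso ((wiring e).comp G) (G.relabel e.symm _root_.id) where
  node :=
    { toFun := Quot.lift (Sum.elim (fun x => G.inp (e.symm x)) _root_.id) (by
        rintro _ _ ⟨i⟩; exact congrArg G.inp (e.symm_apply_apply i))
      invFun x := Quot.mk _ (.inr x)
      left_inv := by
        rintro ⟨x | x⟩
        · have := Quot.sound (Glue.glue (G := wiring e) (H := G) (e.symm x))
          refine this.symm.trans (congrArg (fun y => Quot.mk (Glue (wiring e) G) (Sum.inl y)) ?_)
          exact e.apply_symm_apply x
        · rfl
      right_inv _ := rfl }
  edge k l := Equiv.emptySum Empty _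
  src := by rintro _ _ (e | e) i; exacts [e.elim, rfl]
  tgt := by rintro _ _ (e | e) i; exacts [e.elim, rfl]
  label := by rintro _ _ (e | e); exacts [e.elim, rfl]
  inp i := rfl
  out i := rfl

def tensorInterchange {a b c a' b' c' : ℕ} (G : Cospan Sig a b) (H : Cospan Sig b c)
    (G' : Cospan Sig a' b') (H' : Cospan Sig b' c') :
    Iso ((G.comp H).tensor (G'.comp H')) ((G.tensor G').comp (H.tensor H')) where
  node :=
    { toFun := Sum.elim
        (Quot.map (Sum.map .inl .inl) (by
          rintro _ _ ⟨i⟩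
          have := Glue.glue (G := G.tensor G') (H := H.tensor H') (Fin.castAdd b' i)
          simp only [tensor, Fin.append_left] at this
          exact this))
        (Quot.map (Sum.map .inr .inr) (by
          rintro _ _ ⟨i⟩
          have := Glue.glue (G := G.tensor G') (H := H.tensor H') (Fin.natAdd b i)
          simp only [tensor, Fin.append_right] at this
          exact this))
      invFun := Quot.lift
        (Sum.elim
          (Sum.map (fun x => Quot.mk _ (.inl x)) (fun x => Quot.mk _ (.inl x)))
          (Sum.map (fun x => Quot.mk _ (.inr x)) (fun x => Quot.mk _ (.inr x))))
        (by
          rintro _ _ ⟨i⟩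
          induction i using Fin.addCases with
          | left i =>
            simp only [tensor, Fin.append_left]
            exact congrArg Sum.inl (Quot.sound (Glue.glue (G := G) (H := H) i))
          | right i =>
            simp only [tensor, Fin.append_right]
            exact congrArg Sum.inr (Quot.sound (Glue.glue (G := G') (H := H') i)))
      left_inv := by
        rintro (x | x)
        · obtain ⟨x | x⟩ := x <;> rfl
        · obtain ⟨x | x⟩ := x <;> rfl
      right_inv := by rintro ⟨(x | x) | (x | x)⟩ <;> rfl }
  edge k l := Equiv.sumSumSumComm _ _ _ _
  src := by rintro _ _ ((e | e) | (e | e)) i <;> rfl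
  tgt := by rintro _ _ ((e | e) | (e | e)) i <;> rfl
  label := by rintro _ _ ((e | e) | (e | e)) <;> rfl
  inp i := by induction i using Fin.addCases <;> simp [tensor, comp] <;> rfl
  out i := by induction i using Fin.addCases <;> simp [tensor, comp] <;> rfl

theorem appendAssoc {a b c : ℕ} {X Y Z : Type} (f : Fin a → X) (g : Fin b → Y) (h : Fin c → Z)
    (i : Fin (a + (b + c))) :
    Equiv.sumAssoc X Y Z (Fin.append
      (fun j => Sum.inl (Fin.append (fun i => Sum.inl (f i)) (fun i => Sum.inr (g i)) j))
      (fun j => Sum.inr (h j)) (Fin.cast (Nat.add_assoc a b c).symm i)) =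
    Fin.append (fun i => Sum.inl (f i))
      (fun j => Sum.inr (Fin.append (fun i => Sum.inl (g i)) (fun i => Sum.inr (h i)) j)) i := by
  induction i using Fin.addCases with
  | left i =>
    have : Fin.cast (Nat.add_assoc a b c).symm (Fin.castAdd (b + c) i) =
      Fin.castAdd c (Fin.castAdd b i) := rfl
    simp [this]
  | right i =>
    induction i using Fin.addCases with
    | left i =>
      have : Fin.cast (Nat.add_assoc a b c).symm (Fin.natAdd a (Fin.castAdd c i)) =
        Fin.castAdd c (Fin.natAdd a i) := rfl
      simp [this]
    | right i =>
      have : Fin.cast (Nat.add_assoc a b c).symm (Fin.natAdd a (Fin.natAdd b i)) =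
        Fin.natAdd (a + b) i := by ext; simp [Nat.add_assoc]
      simp [this]

theorem appendZeroLeft {a : ℕ} {X : Type} (f : Fin a → X) (i : Fin a) :
    Fin.append (fun i : Fin 0 => Sum.inl i) (fun i => Sum.inr (f i))
      (Fin.cast (Nat.zero_add a).symm i) = Sum.inr (f i) := by
  have : Fin.cast (Nat.zero_add a).symm i = Fin.natAdd 0 i := by ext; simp
  rw [this, Fin.append_right]

theorem appendZeroRight {a : ℕ} {X : Type} (f : Fin a → X) (i : Fin a) :
    Fin.append (fun i => Sum.inl (f i)) (fun i : Fin 0 => Sum.inr i)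
      (Fin.cast (Nat.add_zero a).symm i) = Sum.inl (f i) := by
  have : Fin.cast (Nat.add_zero a).symm i = Fin.castAdd 0 i := by ext; simp
  rw [this, Fin.append_left]

def tensorAssoc {a b a' b' a'' b'' : ℕ} (G : Cospan Sig a b) (H : Cospan Sig a' b')
    (K : Cospan Sig a'' b'') :
    Iso (((G.tensor H).tensor K).relabel (Fin.cast (Nat.add_assoc a a' a'').symm)
        (Fin.cast (Nat.add_assoc b b' b'').symm)) (G.tensor (H.tensor K)) where
  node := Equiv.sumAssoc _ _ _
  edge k l := Equiv.sumAssoc _ _ _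
  src := by rintro _ _ ((e | e) | e) i <;> rfl
  tgt := by rintro _ _ ((e | e) | e) i <;> rfl
  label := by rintro _ _ ((e | e) | e) <;> rfl
  inp i := (appendAssoc G.inp H.inp K.inp i).symm
  out i := (appendAssoc G.out H.out K.out i).symm

def idZeroTensor {a b : ℕ} (G : Cospan Sig a b) :
    Iso (((id Sig 0).tensor G).relabel (Fin.cast (Nat.zero_add a).symm)
        (Fin.cast (Nat.zero_add b).symm)) G where
  node := Equiv.emptySum (Fin 0) _
  edge k l := Equiv.emptySum Empty _
  src := by rintro _ _ (e | e) i; exacts [e.elim, rfl]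
  tgt := by rintro _ _ (e | e) i; exacts [e.elim, rfl]
  label := by rintro _ _ (e | e); exacts [e.elim, rfl]
  inp i := (congrArg (Equiv.emptySum (Fin 0) G.Node) (appendZeroLeft G.inp i)).symm
  out i := (congrArg (Equiv.emptySum (Fin 0) G.Node) (appendZeroLeft G.out i)).symm

def tensorIdZero {a b : ℕ} (G : Cospan Sig a b) :
    Iso ((G.tensor (id Sig 0)).relabel (Fin.cast (Nat.add_zero a).symm)
        (Fin.cast (Nat.add_zero b).symm)) G where
  node := Equiv.sumEmpty _ (Fin 0)
  edge k l := Equiv.sumEmpty _ Empty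
  src := by rintro _ _ (e | e) i; exacts [rfl, e.elim]
  tgt := by rintro _ _ (e | e) i; exacts [rfl, e.elim]
  label := by rintro _ _ (e | e); exacts [rfl, e.elim]
  inp i := (congrArg (Equiv.sumEmpty G.Node (Fin 0)) (appendZeroRight G.inp i)).symm
  out i := (congrArg (Equiv.sumEmpty G.Node (Fin 0)) (appendZeroRight G.out i)).symm

/-- Disjoint union of functions between finite ordinals. -/
def sumFun {a b a' b' : ℕ} (e : Fin b → Fin a) (e' : Fin b' → Fin a') :
    Fin (b + b') → Fin (a + a') :=
  Fin.append (fun i => Fin.castAdd a' (e i)) (fun i => Fin.natAdd a (e' i))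

def wiringTensor {a b a' b' : ℕ} (e : Fin b → Fin a) (e' : Fin b' → Fin a') :
    Iso ((wiring (Sig := Sig) e).tensor (wiring e')) (wiring (sumFun e e')) where
  node := finSumFinEquiv
  edge k l := Equiv.sumEmpty _ Empty
  src := by rintro _ _ (e | e) i <;> exact e.elim
  tgt := by rintro _ _ (e | e) i <;> exact e.elim
  label := by rintro _ _ (e | e) <;> exact e.elim
  inp i := by induction i using Fin.addCases <;> simp [tensor, wiring] <;> rfl
  out i := by induction i using Fin.addCases <;> simp [tensor, wiring, sumFun] <;> rfl

/-- The block swap as a bijection. -/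
def swapEquiv (a b : ℕ) : Fin (b + a) ≃ Fin (a + b) where
  toFun := swapFun a b
  invFun := swapFun b a
  left_inv i := by induction i using Fin.addCases <;> simp [swapFun]
  right_inv i := by induction i using Fin.addCases <;> simp [swapFun]

def symmNatural {n m : ℕ} (z : ℕ) (G : Cospan Sig n m) :
    Iso ((G.tensor (id Sig z)).relabel _root_.id (swapFun m z))
      (((id Sig z).tensor G).relabel (swapFun z n) _root_.id) where
  node := Equiv.sumComm _ _
  edge k l := Equiv.sumComm _ _
  src := by rintro _ _ (e | e) i <;> rfl
  tgt := by rintro _ _ (e | e) i <;> rfl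
  label := by rintro _ _ (e | e) <;> rfl
  inp i := by
    induction i using Fin.addCases <;> simp [relabel, tensor, swapFun] <;> rfl
  out i := by
    induction i using Fin.addCases <;> simp [relabel, tensor, swapFun] <;> rfl

def wiringCast {a b a' b' : ℕ} (ha : a = a') (hb : b = b') (e : Fin b → Fin a) :
    Iso ((wiring (Sig := Sig) e).relabel (Fin.cast ha.symm) (Fin.cast hb.symm))
      (wiring (fun i => Fin.cast ha (e (Fin.cast hb.symm i)))) where
  node := finCongr ha
  edge k l := Equiv.refl _
  src e := e.elim
  tgt e := e.elim
  label e := e.elim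
  inp i := by simp only [relabel, wiring, _root_.id]; rfl
  out i := by simp only [relabel, wiring, _root_.id]; rfl

def relabelCongr {n m n' m' : ℕ} {G H : Cospan Sig n m} (h : Iso G H) (f : Fin n' → Fin n)
    (g : Fin m' → Fin m) : Iso (G.relabel f g) (H.relabel f g) where
  node := h.node
  edge := h.edge
  src := h.src
  tgt := h.tgt
  label := h.label
  inp i := h.inp (f i)
  out i := h.out (g i)

theorem swapFun_val (a b : ℕ) (i : Fin (b + a)) :
    (swapFun a b i : ℕ) = if (i : ℕ) < b then a + i else i - b := by
  induction i using Fin.addCases <;> simp [swapFun]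

theorem sumFun_val {a b a' b' : ℕ} (e : Fin b → Fin a) (e' : Fin b' → Fin a') (i : Fin (b + b')) :
    (sumFun e e' i : ℕ) = if h : (i : ℕ) < b then (e ⟨i, h⟩ : ℕ) else
      a + e' ⟨i - b, by omega⟩ := by
  induction i using Fin.addCases <;> simp [sumFun]

theorem hexagonFun (a b c : ℕ) :
    swapFun a (b + c) = fun i => Fin.cast (Nat.add_assoc a b c)
      (sumFun (swapFun a b) _root_.id (Fin.cast rfl
        (Fin.cast (Nat.add_assoc b a c).symm (sumFun _root_.id (swapFun a c)
          (Fin.cast (Nat.add_assoc b c a).symm.symm i))))) := by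
  funext i
  ext
  have := i.2
  simp only [swapFun_val, sumFun_val, Fin.val_cast, _root_.id]
  split_ifs <;> omega

end Cospan

/-! ## The PROP of Frobenius termgraphs -/

/-- Arrows `n → m` of the PROP of Frobenius termgraphs: isomorphism classes of cospans
`n → G ← m`. -/
abbrev FTermHom (Sig : Signature.{u}) (n m : ℕ) : Type (max 1 u) :=
  Quotient (Cospan.setoid Sig n m)

/-- Composition of isomorphism classes of cospans. -/
def FTermHom.comp {Sig : Signature.{u}} {a b c : ℕ} :
    FTermHom Sig a b → FTermHom Sig b c → FTermHom Sig a c :=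
  Quotient.map₂ Cospan.comp (fun _ _ ⟨f⟩ _ _ ⟨g⟩ => ⟨Cospan.compCongr f g⟩)

/-- The monoidal product of isomorphism classes of cospans. -/
def FTermHom.tensor {Sig : Signature.{u}} {a b a' b' : ℕ} :
    FTermHom Sig a b → FTermHom Sig a' b' → FTermHom Sig (a + a') (b + b') :=
  Quotient.map₂ Cospan.tensor (fun _ _ ⟨f⟩ _ _ ⟨g⟩ => ⟨Cospan.tensorCongr f g⟩)

theorem castHom_mk {Sig : Signature.{u}} {a b a' b' : ℕ} (ha : a = a') (hb : b = b')
    (G : Cospan Sig a b) :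
    castHom (H := FTermHom Sig) ha hb (Quotient.mk _ G) =
      Quotient.mk _ (G.relabel (Fin.cast ha.symm) (Fin.cast hb.symm)) := by
  subst ha hb; rfl

theorem mk_eq {Sig : Signature.{u}} {n m : ℕ} {G H : Cospan Sig n m} (f : Cospan.Iso G H) :
    (Quotient.mk _ G : FTermHom Sig n m) = Quotient.mk _ H := Quotient.sound ⟨f⟩

theorem wiring_comp_mk {Sig : Signature.{u}} {a b c : ℕ} (e : Fin b → Fin a) (e' : Fin c → Fin b) :
    FTermHom.comp (Quotient.mk _ (Cospan.wiring e) : FTermHom Sig a b)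
      (Quotient.mk _ (Cospan.wiring e')) = Quotient.mk _ (Cospan.wiring (fun i => e (e' i))) :=
  mk_eq (Cospan.compWiring _ _)

open Cospan in
/-- The PROP of Frobenius termgraphs over a signature: the arrows `n → m` are the isomorphism
classes of discrete cospans `n → G ← m`, composition is by pushout and the monoidal product is
disjoint union. -/
def FTerm (Sig : Signature.{u}) : PROP.{max 1 u} where
  Hom := FTermHom Sig
  id n := Quotient.mk _ (Cospan.id Sig n)
  comp := FTermHom.comp
  tensor := FTermHom.tensor
  symm a b := Quotient.mk _ (Cospan.symm Sig a b)
  comp_assoc := by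
    rintro _ _ _ _ ⟨f⟩ ⟨g⟩ ⟨h⟩; exact Quotient.sound ⟨compAssoc f g h⟩
  id_comp := by
    rintro _ _ ⟨f⟩; exact Quotient.sound ⟨wiringComp (Equiv.refl _) f⟩
  comp_id := by
    rintro _ _ ⟨f⟩; exact Quotient.sound ⟨compWiring f _⟩
  tensor_assoc := by
    rintro _ _ _ _ _ _ ⟨f⟩ ⟨g⟩ ⟨h⟩
    exact (castHom_mk _ _ _).trans (Quotient.sound ⟨tensorAssoc f g h⟩)
  id_zero_tensor := by
    rintro _ _ ⟨f⟩; exact (castHom_mk _ _ _).trans (Quotient.sound ⟨idZeroTensor f⟩)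
  tensor_id_zero := by
    rintro _ _ ⟨f⟩; exact (castHom_mk _ _ _).trans (Quotient.sound ⟨tensorIdZero f⟩)
  tensor_id a b := by
    refine (mk_eq (wiringTensor _ _)).trans (congrArg (fun e => Quotient.mk _ (wiring e)) ?_)
    funext i
    induction i using Fin.addCases <;> simp [sumFun]
  interchange := by
    rintro _ _ _ _ _ _ ⟨f⟩ ⟨g⟩ ⟨f'⟩ ⟨g'⟩
    exact Quotient.sound ⟨tensorInterchange f g f' g'⟩
  symm_symm a b := by
    refine (mk_eq (compWiring _ _)).trans (congrArg (fun e => Quotient.mk _ (wiring e)) ?_)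
    exact funext fun i => (swapEquiv b a).symm_apply_apply i
  symm_natural := by
    rintro n m z ⟨f⟩
    exact Quotient.sound ⟨(compWiring _ _).trans ((symmNatural z f).trans
      (wiringComp (swapEquiv n z) _).symm)⟩
  hexagon a b c := by
    have h1 := (castHom_mk (Nat.add_assoc a b c) rfl
      ((Cospan.symm Sig a b).tensor (Cospan.id Sig c))).trans
      (mk_eq ((relabelCongr (wiringTensor _ _) _ _).trans (wiringCast (Nat.add_assoc a b c) rfl _)))
    have h2 := (castHom_mk (Nat.add_assoc b a c).symm (Nat.add_assoc b c a).symm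
      ((Cospan.id Sig b).tensor (Cospan.symm Sig a c))).trans
      (mk_eq ((relabelCongr (wiringTensor _ _) _ _).trans (wiringCast (Nat.add_assoc b a c).symm (Nat.add_assoc b c a).symm _)))
    refine Eq.trans ?_ (congrArg₂ FTermHom.comp h1 h2).symm
    refine Eq.trans ?_ (wiring_comp_mk _ _).symm
    exact congrArg (fun e => Quotient.mk _ (wiring e)) (hexagonFun a b c)

/-- The PROP morphism from the free PROP on `Sig` to Frobenius termgraphs that sends each generator
`o : n → m` to the cospan of a single hyperedge labelled `o`. -/
def interp (Sig : Signature.{u}) : PROPHom (freePROP Sig) (FTerm Sig) :=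
  freePROP.lift (FTerm Sig) (fun o => Quotient.mk _ (Cospan.gen o))

end FrobTerm

/-! Both sides are compared with one combinatorial condition, `MonogamousAcyclic`. Monogamy says
that every node begins at exactly one place (an input or a target of a hyperedge) and ends at
exactly one place (an output or a source), i.e. that `entry` and `exit` are bijective. Acyclicity of
a finite hypergraph says that some rank on nodes increases strictly along every hyperedge.

Soundness is an induction on terms: generators and bijective wirings satisfy the condition, and
composition and tensor preserve it. In a composite, a glued node begins where it began in the first
factor and ends where it ended in the second, and no hyperedge leads from the second factor back to
the first.

Completeness is an induction on the number of hyperedges. Without hyperedges, the cospan is a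
permutation of wires, hence a product of adjacent transpositions, each a tensor of identities with
one symmetry. Otherwise acyclicity gives a hyperedge all of whose sources are inputs
(`exists_initial_edge`). After a permutation of the inputs its sources come first, and the cospan
factors as that generator, tensored with identity wires, followed by the cospan with the hyperedge
removed (`removeEdgeIso`), which is smaller and again monogamous and acyclic. -/

namespace FrobTerm

/-! ### Acyclicity and rank functions -/

namespace Hypergraph

variable {Sig : Signature.{u}} {G : Hypergraph Sig}

theorem exists_isPath_of_transGen {v w : G.Node}
    (h : Relation.TransGen (fun v w => ∃ e, G.IsSource v e ∧ G.IsTarget w e) v w) :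
    ∃ p, G.IsPath v p w := by
  induction h using Relation.TransGen.head_induction_on with
  | single h =>
    obtain ⟨e, hs, ht⟩ := h
    exact ⟨[e], List.isChain_singleton e, ⟨e, rfl, hs⟩, ⟨e, rfl, ht⟩⟩
  | head h _ ih =>
    obtain ⟨e, hs, ht⟩ := h
    obtain ⟨_ | ⟨e', p⟩, hc, ⟨x, hx, hxs⟩, hl⟩ := ih
    · simp at hx
    · obtain rfl : e' = x := by simpa using hx
      exact ⟨e :: e' :: p, List.isChain_cons_cons.2 ⟨⟨_, ht, hxs⟩, hc⟩, ⟨e, rfl, hs⟩,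
        by simpa only [List.getLast?_cons_cons] using hl⟩

/-- Consecutive hyperedges of a path share a node, so the increases of rank along them add up. With
`v = w` this excludes cycles. -/
theorem IsPath.rank_lt {ρ : G.Node → ℕ}
    (hρ : ∀ e v w, G.IsSource v e → G.IsTarget w e → ρ v < ρ w)
    {p : List G.AnyEdge} {v w : G.Node} (h : G.IsPath v p w) : ρ v < ρ w := by
  induction p generalizing v with
  | nil => obtain ⟨-, ⟨x, hx, -⟩, -⟩ := h; simp at hx
  | cons e p ih =>
    obtain ⟨hc, ⟨x, hx, hxs⟩, hl⟩ := h
    obtain rfl : e = x := by simpa using hx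
    obtain _ | ⟨e', p⟩ := p
    · obtain ⟨y, hy, hyt⟩ := hl
      obtain rfl : e = y := by simpa using hy
      exact hρ _ _ _ hxs hyt
    · obtain ⟨⟨u, hut, hus⟩, hc⟩ := List.isChain_cons_cons.1 hc
      refine (hρ _ _ _ hxs hut).trans (ih ⟨hc, ⟨e', rfl, hus⟩, ?_⟩)
      simpa only [List.getLast?_cons_cons] using hl

/-- A finite hypergraph is directed acyclic iff its nodes can be ranked so that every hyperedge
goes from smaller to larger ranks. -/
theorem directedAcyclic_iff_exists_rank :
    G.DirectedAcyclic ↔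
      ∃ ρ : G.Node → ℕ, ∀ {k l} (e : G.Edge k l) i j, ρ (G.src e i) < ρ (G.tgt e j) := by
  constructor
  · intro hG
    have := G.node_finite
    let R := Relation.TransGen (fun v w => ∃ e, G.IsSource v e ∧ G.IsTarget w e)
    -- The rank of a node is the number of nodes that reach it by a nonempty path. Along a hyperedge
    -- this set grows by transitivity, and strictly: the source reaches the target, but would lie on
    -- a cycle if it reached itself.
    refine ⟨fun v => {u | R u v}.ncard, fun {k l} e i j => ?_⟩
    have h : R (G.src e i) (G.tgt e j) := .single ⟨⟨k, l, e⟩, ⟨i, rfl⟩, ⟨j, rfl⟩⟩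
    refine Set.ncard_lt_ncard ⟨fun u hu => Relation.TransGen.trans hu h, fun hsub => ?_⟩
    obtain ⟨p, hp⟩ := exists_isPath_of_transGen (hsub h)
    exact hG _ _ hp
  · rintro ⟨ρ, hρ⟩ v p hp
    refine lt_irrefl _ (hp.rank_lt (ρ := ρ) ?_)
    rintro ⟨k, l, e⟩ _ _ ⟨i, rfl⟩ ⟨j, rfl⟩
    exact hρ e i j

end Hypergraph

/-! ### Monogamy as bijectivity of `entry` and `exit` -/

namespace Cospan

variable {Sig : Signature.{u}}

/-- The places where a node of `G` can begin: the inputs of `G` and the targets of its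
hyperedges. -/
def entry {n m : ℕ} (G : Cospan Sig n m) : Fin n ⊕ (Σ h : G.AnyEdge, Fin h.2.1) → G.Node :=
  Sum.elim G.inp (fun p => G.tgt p.1.2.2 p.2)

/-- The places where a node of `G` can end: the outputs of `G` and the sources of its
hyperedges. -/
def exit {n m : ℕ} (G : Cospan Sig n m) : Fin m ⊕ (Σ h : G.AnyEdge, Fin h.1) → G.Node :=
  Sum.elim G.out (fun p => G.src p.1.2.2 p.2)

/-- Each point must have a single preimage; once `f` is injective, the fibre of `g` has to supply it
exactly off the range of `f`. With a leg as `f` and the targets or sources as `g`, the fibre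
cardinalities are the degrees in the definition of monogamy. -/
theorem bijective_sumElim_iff {A B V : Type} (f : A → V) (g : B → V) :
    Function.Bijective (Sum.elim f g) ↔ Function.Injective f ∧ ∀ v,
      (v ∈ Set.range f → ENat.card {b // g b = v} = 0) ∧
      (v ∉ Set.range f → ENat.card {b // g b = v} = 1) := by
  simp only [ENat.card_eq_zero_iff_empty, ENat.card_eq_one_iff_unique]
  constructor
  · rintro ⟨hi, hs⟩
    refine ⟨fun a a' h => Sum.inl_injective (hi h), fun v => ⟨?_, fun hv => ?_⟩⟩
    · rintro ⟨a, rfl⟩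
      exact ⟨fun ⟨b, hb⟩ => by simpa using @hi (.inr b) (.inl a) hb⟩
    · obtain ⟨a | b, rfl⟩ := hs v
      · exact absurd ⟨a, rfl⟩ hv
      · exact ⟨⟨⟨⟨b, rfl⟩⟩, fun ⟨b', hb'⟩ =>
          Subtype.ext (Sum.inr_injective (@hi (.inr b') (.inr b) hb'))⟩⟩
  · rintro ⟨hf, hv⟩
    refine ⟨?_, fun v => ?_⟩
    · refine hf.sumElim (fun b b' hb => ?_) (fun a b hab => ?_)
      · by_cases h : g b ∈ Set.range f
        · exact (((hv _).1 h).false ⟨b, rfl⟩).elim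
        · obtain ⟨U⟩ := (hv _).2 h
          have h1 := U.uniq ⟨b, rfl⟩
          have h2 := U.uniq ⟨b', hb.symm⟩
          exact congrArg Subtype.val (h1.trans h2.symm)
      · exact ((hv (g b)).1 ⟨a, hab⟩).false ⟨b, rfl⟩
    · by_cases h : v ∈ Set.range f
      · obtain ⟨a, rfl⟩ := h
        exact ⟨.inl a, rfl⟩
      · obtain ⟨U⟩ := (hv _).2 h
        exact ⟨.inr U.default.1, U.default.2⟩

/-- A cospan is monogamous iff every node begins at exactly one place and ends at exactly one
place. -/
theorem monogamous_iff {n m : ℕ} (G : Cospan Sig n m) :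
    G.Monogamous ↔ Function.Bijective G.entry ∧ Function.Bijective G.exit := by
  rw [entry, exit, bijective_sumElim_iff, bijective_sumElim_iff]
  simp only [Monogamous, Hypergraph.indegree, Hypergraph.outdegree]
  grind

/-- Monogamous cospans with a rank function on nodes that witnesses directed acyclicity. -/
structure MonogamousAcyclic {n m : ℕ} (G : Cospan Sig n m) : Prop where
  entry_bijective : Function.Bijective G.entry
  exit_bijective : Function.Bijective G.exit
  exists_rank : ∃ ρ : G.Node → ℕ, ∀ {k l} (e : G.Edge k l) i j, ρ (G.src e i) < ρ (G.tgt e j)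

theorem monogamousAcyclic_iff {n m : ℕ} {G : Cospan Sig n m} :
    G.MonogamousAcyclic ↔ G.Monogamous ∧ G.DirectedAcyclic := by
  rw [monogamous_iff, Hypergraph.directedAcyclic_iff_exists_rank]
  exact ⟨fun h => ⟨⟨h.1, h.2⟩, h.3⟩, fun h => ⟨h.1.1, h.1.2, h.2⟩⟩

/-! ### Closure properties -/

theorem MonogamousAcyclic.of_iso {n m : ℕ} {G H : Cospan Sig n m} (f : Iso G H)
    (hG : G.MonogamousAcyclic) : H.MonogamousAcyclic := by
  obtain ⟨⟨hei, hes⟩, ⟨hxi, hxs⟩, ρ, hρ⟩ := hG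
  have hedge : ∀ {k l} (e : H.Edge k l), ∃ e', f.edge k l e' = e := (f.edge _ _).surjective
  refine ⟨⟨?_, fun v => ?_⟩, ⟨?_, fun v => ?_⟩, ρ ∘ f.node.symm, fun e i j => ?_⟩
  -- An explicit retraction spares the comparison of dependent pairs of hyperedges and positions;
  -- the same device serves for composites and tensors.
  · refine Function.LeftInverse.injective
      (g := fun v => Sum.map _root_.id (fun p => ⟨⟨p.1.1, p.1.2.1, f.edge _ _ p.1.2.2⟩, p.2⟩)
        ((Equiv.ofBijective _ ⟨hei, hes⟩).symm (f.node.symm v))) ?_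
    rintro (i | ⟨⟨k, l, e⟩, i⟩)
    · have : f.node.symm (H.entry (.inl i)) = Equiv.ofBijective _ ⟨hei, hes⟩ (.inl i) :=
        f.node.symm_apply_eq.2 (f.inp i)
      simp only [this, Equiv.symm_apply_apply]; rfl
    · obtain ⟨e, rfl⟩ := hedge e
      have : f.node.symm (H.entry (.inr ⟨⟨k, l, f.edge k l e⟩, i⟩)) =
          Equiv.ofBijective _ ⟨hei, hes⟩ (.inr ⟨⟨k, l, e⟩, i⟩) :=
        f.node.symm_apply_eq.2 (f.tgt e i)
      simp only [this, Equiv.symm_apply_apply]; rfl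
  · obtain ⟨i | ⟨⟨k, l, e⟩, i⟩, h⟩ := hes (f.node.symm v)
    · exact ⟨.inl i, (f.inp i).trans (f.node.eq_symm_apply.1 h)⟩
    · exact ⟨.inr ⟨⟨k, l, f.edge k l e⟩, i⟩, (f.tgt e i).trans (f.node.eq_symm_apply.1 h)⟩
  · refine Function.LeftInverse.injective
      (g := fun v => Sum.map _root_.id (fun p => ⟨⟨p.1.1, p.1.2.1, f.edge _ _ p.1.2.2⟩, p.2⟩)
        ((Equiv.ofBijective _ ⟨hxi, hxs⟩).symm (f.node.symm v))) ?_
    rintro (i | ⟨⟨k, l, e⟩, i⟩)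
    · have : f.node.symm (H.exit (.inl i)) = Equiv.ofBijective _ ⟨hxi, hxs⟩ (.inl i) :=
        f.node.symm_apply_eq.2 (f.out i)
      simp only [this, Equiv.symm_apply_apply]; rfl
    · obtain ⟨e, rfl⟩ := hedge e
      have : f.node.symm (H.exit (.inr ⟨⟨k, l, f.edge k l e⟩, i⟩)) =
          Equiv.ofBijective _ ⟨hxi, hxs⟩ (.inr ⟨⟨k, l, e⟩, i⟩) :=
        f.node.symm_apply_eq.2 (f.src e i)
      simp only [this, Equiv.symm_apply_apply]; rfl
  · obtain ⟨i | ⟨⟨k, l, e⟩, i⟩, h⟩ := hxs (f.node.symm v)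
    · exact ⟨.inl i, (f.out i).trans (f.node.eq_symm_apply.1 h)⟩
    · exact ⟨.inr ⟨⟨k, l, f.edge k l e⟩, i⟩, (f.src e i).trans (f.node.eq_symm_apply.1 h)⟩
  · obtain ⟨e, rfl⟩ := hedge e
    simpa [f.src, f.tgt] using hρ e i j

theorem monogamousAcyclic_wiring {n m : ℕ} {e : Fin m → Fin n} (he : Function.Bijective e) :
    (wiring (Sig := Sig) e).MonogamousAcyclic := by
  refine ⟨⟨?_, fun v => ⟨.inl v, rfl⟩⟩, ⟨?_, fun v => ?_⟩, fun _ => 0, fun e => e.elim⟩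
  · rintro (i | ⟨⟨k, l, e⟩, i⟩) (j | ⟨⟨k', l', e'⟩, j⟩) h
    exacts [congrArg Sum.inl h, e'.elim, e.elim, e.elim]
  · rintro (i | ⟨⟨k, l, e⟩, i⟩) (j | ⟨⟨k', l', e'⟩, j⟩) h
    exacts [congrArg Sum.inl (he.1 h), e'.elim, e.elim, e.elim]
  · obtain ⟨i, rfl⟩ := he.2 v
    exact ⟨.inl i, rfl⟩

theorem monogamousAcyclic_gen {n m : ℕ} (o : Sig n m) : (gen o).MonogamousAcyclic := by
  refine ⟨⟨?_, ?_⟩, ⟨?_, ?_⟩, Sum.elim (fun _ => 0) (fun _ => 1), fun e i j => Nat.one_pos⟩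
  · rintro (i | ⟨⟨k, l, ⟨⟩, rfl, rfl⟩, i⟩) (j | ⟨⟨k', l', ⟨⟩, h1, h2⟩, j⟩) h
    · exact congrArg Sum.inl (Sum.inl_injective h)
    · cases h
    · cases h
    · subst h1 h2
      have : i = j := Sum.inr_injective h
      rw [this]
  · rintro (i | i)
    exacts [⟨.inl i, rfl⟩, ⟨.inr ⟨⟨n, m, ⟨(), rfl, rfl⟩⟩, i⟩, rfl⟩]
  · rintro (i | ⟨⟨k, l, ⟨⟩, rfl, rfl⟩, i⟩) (j | ⟨⟨k', l', ⟨⟩, h1, h2⟩, j⟩) h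
    · exact congrArg Sum.inl (Sum.inr_injective h)
    · cases h
    · cases h
    · subst h1 h2
      have : i = j := Sum.inl_injective h
      rw [this]
  · rintro (i | i)
    exacts [⟨.inr ⟨⟨n, m, ⟨(), rfl, rfl⟩⟩, i⟩, rfl⟩, ⟨.inl i, rfl⟩]

/-- Gluing cancels an output of `G` against an input of `H`: the merged node keeps its beginning
from `G` and its end from `H`. All hyperedges of `H` can be ranked after those of `G`. -/
theorem MonogamousAcyclic.comp {a b c : ℕ} {G : Cospan Sig a b} {H : Cospan Sig b c}
    (hG : G.MonogamousAcyclic) (hH : H.MonogamousAcyclic) : (G.comp H).MonogamousAcyclic := by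
  obtain ⟨hGe, hGx, ρ, hρ⟩ := hG
  obtain ⟨hHe, hHx, τ, hτ⟩ := hH
  obtain ⟨g, hg, -⟩ := Function.bijective_iff_has_inverse.1 hGe
  obtain ⟨h, hh, -⟩ := Function.bijective_iff_has_inverse.1 hHe
  obtain ⟨g', hg', -⟩ := Function.bijective_iff_has_inverse.1 hGx
  obtain ⟨h', hh', -⟩ := Function.bijective_iff_has_inverse.1 hHx
  have hinp : ∀ i, h (H.inp i) = .inl i := fun i => hh (.inl i)
  have htgt : ∀ {k l} (e : H.Edge k l) i, h (H.tgt e i) = .inr ⟨⟨k, l, e⟩, i⟩ :=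
    fun e i => hh (.inr ⟨⟨_, _, e⟩, i⟩)
  have hout : ∀ i, g' (G.out i) = .inl i := fun i => hg' (.inl i)
  have hsrc : ∀ {k l} (e : G.Edge k l) i, g' (G.src e i) = .inr ⟨⟨k, l, e⟩, i⟩ :=
    fun e i => hg' (.inr ⟨⟨_, _, e⟩, i⟩)
  have hglue (i) : Quot.mk (Glue G H) (.inl (G.out i)) = Quot.mk _ (.inr (H.inp i)) :=
    Quot.sound (.glue i)
  refine ⟨⟨?_, ?_⟩, ⟨?_, ?_⟩, ?_⟩
  · let L : Fin a ⊕ (Σ h : G.AnyEdge, Fin h.2.1) → Fin a ⊕ (Σ h : (G.comp H).AnyEdge, Fin h.2.1) :=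
      Sum.map _root_.id (fun p => ⟨⟨p.1.1, p.1.2.1, .inl p.1.2.2⟩, p.2⟩)
    -- A node of `H` that begins at its input `i` is traced back to the beginning of the `i`-th
    -- output of `G`; any other node of `H` begins at a hyperedge of `H`.
    refine Function.LeftInverse.injective (g := Quot.lift (Sum.elim (fun x => L (g x))
      (fun y => Sum.elim (fun i => L (g (G.out i)))
        (fun p => .inr ⟨⟨p.1.1, p.1.2.1, .inr p.1.2.2⟩, p.2⟩) (h y))) ?_) ?_
    · rintro _ _ ⟨i⟩
      simp [hinp]
    · rintro (i | ⟨⟨k, l, e | e⟩, i⟩)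
      · exact congrArg L (hg (.inl i))
      · exact congrArg L (hg (.inr ⟨⟨k, l, e⟩, i⟩))
      · exact (congrArg (Sum.elim _ _) (htgt e i))
  · have hl (x) : ∃ p, (G.comp H).entry p = Quot.mk _ (.inl x) := by
      obtain ⟨i | ⟨⟨k, l, e⟩, i⟩, rfl⟩ := hGe.2 x
      exacts [⟨.inl i, rfl⟩, ⟨.inr ⟨⟨k, l, .inl e⟩, i⟩, rfl⟩]
    rintro ⟨x | y⟩
    · exact hl x
    · obtain ⟨i | ⟨⟨k, l, e⟩, i⟩, rfl⟩ := hHe.2 y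
      · obtain ⟨p, hp⟩ := hl (G.out i)
        exact ⟨p, hp.trans (hglue i)⟩
      · exact ⟨.inr ⟨⟨k, l, .inr e⟩, i⟩, rfl⟩
  · let R : Fin c ⊕ (Σ h : H.AnyEdge, Fin h.1) → Fin c ⊕ (Σ h : (G.comp H).AnyEdge, Fin h.1) :=
      Sum.map _root_.id (fun p => ⟨⟨p.1.1, p.1.2.1, .inr p.1.2.2⟩, p.2⟩)
    -- Dually, a node of `G` that ends at an output is followed into `H`.
    refine Function.LeftInverse.injective (g := Quot.lift (Sum.elim
      (fun x => Sum.elim (fun i => R (h' (H.inp i)))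
        (fun p => .inr ⟨⟨p.1.1, p.1.2.1, .inl p.1.2.2⟩, p.2⟩) (g' x))
      (fun y => R (h' y))) ?_) ?_
    · rintro _ _ ⟨i⟩
      simp [hout]
    · rintro (i | ⟨⟨k, l, e | e⟩, i⟩)
      · exact congrArg R (hh' (.inl i))
      · exact (congrArg (Sum.elim _ _) (hsrc e i))
      · exact congrArg R (hh' (.inr ⟨⟨k, l, e⟩, i⟩))
  · have hr (y) : ∃ p, (G.comp H).exit p = Quot.mk _ (.inr y) := by
      obtain ⟨i | ⟨⟨k, l, e⟩, i⟩, rfl⟩ := hHx.2 y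
      exacts [⟨.inl i, rfl⟩, ⟨.inr ⟨⟨k, l, .inr e⟩, i⟩, rfl⟩]
    rintro ⟨x | y⟩
    · obtain ⟨i | ⟨⟨k, l, e⟩, i⟩, rfl⟩ := hGx.2 x
      · obtain ⟨p, hp⟩ := hr (H.inp i)
        exact ⟨p, hp.trans (hglue i).symm⟩
      · exact ⟨.inr ⟨⟨k, l, .inl e⟩, i⟩, rfl⟩
    · exact hr y
  · have := G.node_finite
    obtain ⟨N, hN⟩ := (Set.finite_range ρ).bddAbove
    have hN (x) : ρ x ≤ N := hN ⟨x, rfl⟩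
    -- Inputs of `H` must take the rank of the outputs they are glued to, which is at most `N`. The
    -- other nodes of `H` are shifted above `N`; every target of a hyperedge of `H` is among them,
    -- since it is not an input.
    refine ⟨Quot.lift (Sum.elim ρ (fun y => Sum.elim (fun i => ρ (G.out i))
      (fun _ => τ y + N + 1) (h y))) ?_, ?_⟩
    · rintro _ _ ⟨i⟩
      simp [hinp]
    · rintro k l (e | e) i j
      · exact hρ e i j
      · change Sum.elim _ _ (Sum.inr _) < Sum.elim _ _ (Sum.inr _)
        rw [Sum.elim_inr, Sum.elim_inr, htgt, Sum.elim_inr]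
        have h1 := hτ e i j
        rcases h (H.src e i) with i | p
        · have := hN (G.out i)
          simp only [Sum.elim_inl]
          omega
        · simp only [Sum.elim_inr]
          omega

theorem MonogamousAcyclic.tensor {a b a' b' : ℕ} {G : Cospan Sig a b} {H : Cospan Sig a' b'}
    (hG : G.MonogamousAcyclic) (hH : H.MonogamousAcyclic) : (G.tensor H).MonogamousAcyclic := by
  obtain ⟨hGe, hGx, ρ, hρ⟩ := hG
  obtain ⟨hHe, hHx, τ, hτ⟩ := hH
  obtain ⟨g, hg, -⟩ := Function.bijective_iff_has_inverse.1 hGe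
  obtain ⟨h, hh, -⟩ := Function.bijective_iff_has_inverse.1 hHe
  obtain ⟨g', hg', -⟩ := Function.bijective_iff_has_inverse.1 hGx
  obtain ⟨h', hh', -⟩ := Function.bijective_iff_has_inverse.1 hHx
  have hil (i) : (G.tensor H).inp (Fin.castAdd a' i) = .inl (G.inp i) := by
    simp [Cospan.tensor]
  have hir (i) : (G.tensor H).inp (Fin.natAdd a i) = .inr (H.inp i) := by
    simp [Cospan.tensor]
  have hol (i) : (G.tensor H).out (Fin.castAdd b' i) = .inl (G.out i) := by
    simp [Cospan.tensor]
  have hor (i) : (G.tensor H).out (Fin.natAdd b i) = .inr (H.out i) := by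
    simp [Cospan.tensor]
  refine ⟨⟨?_, ?_⟩, ⟨?_, ?_⟩, Sum.elim ρ τ, ?_⟩
  · refine Function.LeftInverse.injective (g := Sum.elim
      (fun x => Sum.map (Fin.castAdd a') (fun p => ⟨⟨p.1.1, p.1.2.1, .inl p.1.2.2⟩, p.2⟩) (g x))
      (fun y => Sum.map (Fin.natAdd a) (fun p => ⟨⟨p.1.1, p.1.2.1, .inr p.1.2.2⟩, p.2⟩) (h y))) ?_
    rintro (i | ⟨⟨k, l, e | e⟩, i⟩)
    · induction i using Fin.addCases with
      | left i =>
        exact (congrArg (Sum.elim _ _) (hil i)).trans (congrArg (Sum.map _ _) (hg (.inl i)))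
      | right i =>
        exact (congrArg (Sum.elim _ _) (hir i)).trans (congrArg (Sum.map _ _) (hh (.inl i)))
    · exact congrArg (Sum.map _ _) (hg (.inr ⟨⟨k, l, e⟩, i⟩))
    · exact congrArg (Sum.map _ _) (hh (.inr ⟨⟨k, l, e⟩, i⟩))
  · rintro (x | y)
    · obtain ⟨i | ⟨⟨k, l, e⟩, i⟩, rfl⟩ := hGe.2 x
      exacts [⟨.inl _, hil i⟩, ⟨.inr ⟨⟨k, l, .inl e⟩, i⟩, rfl⟩]
    · obtain ⟨i | ⟨⟨k, l, e⟩, i⟩, rfl⟩ := hHe.2 y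
      exacts [⟨.inl _, hir i⟩, ⟨.inr ⟨⟨k, l, .inr e⟩, i⟩, rfl⟩]
  · refine Function.LeftInverse.injective (g := Sum.elim
      (fun x => Sum.map (Fin.castAdd b') (fun p => ⟨⟨p.1.1, p.1.2.1, .inl p.1.2.2⟩, p.2⟩) (g' x))
      (fun y => Sum.map (Fin.natAdd b) (fun p => ⟨⟨p.1.1, p.1.2.1, .inr p.1.2.2⟩, p.2⟩) (h' y))) ?_
    rintro (i | ⟨⟨k, l, e | e⟩, i⟩)
    · induction i using Fin.addCases with
      | left i =>
        exact (congrArg (Sum.elim _ _) (hol i)).trans (congrArg (Sum.map _ _) (hg' (.inl i)))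
      | right i =>
        exact (congrArg (Sum.elim _ _) (hor i)).trans (congrArg (Sum.map _ _) (hh' (.inl i)))
    · exact congrArg (Sum.map _ _) (hg' (.inr ⟨⟨k, l, e⟩, i⟩))
    · exact congrArg (Sum.map _ _) (hh' (.inr ⟨⟨k, l, e⟩, i⟩))
  · rintro (x | y)
    · obtain ⟨i | ⟨⟨k, l, e⟩, i⟩, rfl⟩ := hGx.2 x
      exacts [⟨.inl _, hol i⟩, ⟨.inr ⟨⟨k, l, .inl e⟩, i⟩, rfl⟩]
    · obtain ⟨i | ⟨⟨k, l, e⟩, i⟩, rfl⟩ := hHx.2 y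
      exacts [⟨.inl _, hor i⟩, ⟨.inr ⟨⟨k, l, .inr e⟩, i⟩, rfl⟩]
  · rintro k l (e | e) i j
    exacts [hρ e i j, hτ e i j]

end Cospan

theorem exists_monogamousAcyclic_eval {Sig : Signature.{u}} {n m : ℕ} (t : Term Sig n m) :
    ∃ G : Cospan Sig n m, G.MonogamousAcyclic ∧
      t.eval (FTerm Sig) (fun o => Quotient.mk _ (Cospan.gen o)) = Quotient.mk _ G := by
  induction t with
  | gen o => exact ⟨_, Cospan.monogamousAcyclic_gen o, rfl⟩
  | id n => exact ⟨_, Cospan.monogamousAcyclic_wiring Function.bijective_id, rfl⟩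
  | symm a b => exact ⟨_, Cospan.monogamousAcyclic_wiring (Cospan.swapEquiv a b).bijective, rfl⟩
  | comp f g ihf ihg =>
    obtain ⟨F, hF, hf⟩ := ihf
    obtain ⟨G, hG, hg⟩ := ihg
    exact ⟨F.comp G, hF.comp hG, congrArg₂ FTermHom.comp hf hg⟩
  | tensor f g ihf ihg =>
    obtain ⟨F, hF, hf⟩ := ihf
    obtain ⟨G, hG, hg⟩ := ihg
    exact ⟨F.tensor G, hF.tensor hG, congrArg₂ FTermHom.tensor hf hg⟩

/-! ### Cospans in the image, and their closure properties -/

namespace Cospan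

variable {Sig : Signature.{u}}

/-- The cospans that are denoted by terms. -/
def IsDenoted {n m : ℕ} (G : Cospan Sig n m) : Prop :=
  ∃ t : Term Sig n m, t.eval (FTerm Sig) (fun o => Quotient.mk _ (gen o)) = Quotient.mk _ G

theorem IsDenoted.of_iso {n m : ℕ} {G H : Cospan Sig n m} (f : Iso G H) (hG : G.IsDenoted) :
    H.IsDenoted := by
  obtain ⟨t, ht⟩ := hG
  exact ⟨t, ht.trans (mk_eq f)⟩

theorem IsDenoted.comp {a b c : ℕ} {G : Cospan Sig a b} {H : Cospan Sig b c}
    (hG : G.IsDenoted) (hH : H.IsDenoted) : (G.comp H).IsDenoted := by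
  obtain ⟨s, hs⟩ := hG
  obtain ⟨t, ht⟩ := hH
  exact ⟨s.comp t, congrArg₂ FTermHom.comp hs ht⟩

theorem IsDenoted.tensor {a b a' b' : ℕ} {G : Cospan Sig a b} {H : Cospan Sig a' b'}
    (hG : G.IsDenoted) (hH : H.IsDenoted) : (G.tensor H).IsDenoted := by
  obtain ⟨s, hs⟩ := hG
  obtain ⟨t, ht⟩ := hH
  exact ⟨s.tensor t, congrArg₂ FTermHom.tensor hs ht⟩

theorem isDenoted_gen {n m : ℕ} (o : Sig n m) : (gen o).IsDenoted := ⟨.gen o, rfl⟩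

theorem isDenoted_id (n : ℕ) : (id Sig n).IsDenoted := ⟨.id n, rfl⟩

theorem isDenoted_symm (a b : ℕ) : (symm Sig a b).IsDenoted := ⟨.symm a b, rfl⟩

/-! ### Permutations -/

/-- Arities built by tensoring agree with the desired ones only up to propositional equality, so
wirings are compared through the numerical values of their legs. -/
theorem IsDenoted.wiring_congr {a b a' b' : ℕ} {e : Fin b → Fin a}
    (he : (wiring e : Cospan Sig a b).IsDenoted)
    (ha : a = a') (hb : b = b') {e' : Fin b' → Fin a'}
    (h : ∀ i, (e (Fin.cast hb.symm i) : ℕ) = e' i) : (wiring e' : Cospan Sig a' b').IsDenoted := by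
  subst ha hb
  obtain rfl : e = e' := funext fun i => Fin.ext (h i)
  exact he

/-- The transposition is `id i ⊗ symm 1 1 ⊗ id r`, where `r` is the number of wires after the two
that cross. -/
theorem isDenoted_wiring_swap {n : ℕ} (i : Fin n) :
    (wiring (Sig := Sig) (Equiv.swap i.castSucc i.succ)).IsDenoted := by
  obtain ⟨r, hr⟩ : ∃ r, n = i + 1 + r := ⟨n - (i + 1), by omega⟩
  have h1 := (((isDenoted_id (Sig := Sig) i).tensor (isDenoted_symm 1 1)).of_iso
    (wiringTensor _ _)).tensor (isDenoted_id r)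
  refine (h1.of_iso (wiringTensor _ _)).wiring_congr (by omega) (by omega) fun j => ?_
  have := j.2
  rw [Equiv.swap_apply_def]
  simp only [sumFun_val, swapFun_val, Fin.val_cast, _root_.id, Fin.ext_iff, Fin.val_castSucc,
    Fin.val_succ]
  split_ifs <;> (try simp only [Fin.val_castSucc, Fin.val_succ]) <;> omega

/-- Adjacent transpositions generate the symmetric group, already as a monoid, so closure under
composition suffices. -/
theorem isDenoted_wiring_perm {n : ℕ} (σ : Equiv.Perm (Fin n)) :
    (wiring (Sig := Sig) σ).IsDenoted := by
  obtain _ | n := n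
  · rw [Subsingleton.elim (σ : Fin 0 → Fin 0) _root_.id]
    exact isDenoted_id 0
  · have hσ : σ ∈ Submonoid.closure
        (Set.range fun i : Fin n => Equiv.swap i.castSucc i.succ) := by
      rw [Equiv.Perm.mclosure_swap_castSucc_succ]; trivial
    induction hσ using Submonoid.closure_induction with
    | mem _ h =>
      obtain ⟨i, rfl⟩ := h
      exact isDenoted_wiring_swap i
    | one => exact isDenoted_id _
    -- The right leg of the composite is `σ ∘ τ`, so diagrammatic composition of wirings matches the
    -- product `σ * τ` without reversal.
    | mul σ τ _ _ hσ hτ => exact (hσ.comp hτ).of_iso (compWiring _ _)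

theorem isDenoted_wiring_equiv {n m : ℕ} (σ : Fin m ≃ Fin n) :
    (wiring (Sig := Sig) σ).IsDenoted := by
  obtain rfl : m = n := by simpa using Fintype.card_congr σ
  exact isDenoted_wiring_perm σ

/-- Precomposition with the wiring of `σ` undoes the relabelling, so inputs may be permuted freely
before a cospan is decomposed. -/
theorem IsDenoted.of_relabel {n n' m : ℕ} {G : Cospan Sig n m} (σ : Fin n' ≃ Fin n)
    (h : (G.relabel σ _root_.id).IsDenoted) : G.IsDenoted := by
  refine ((isDenoted_wiring_equiv σ).comp h).of_iso ((wiringComp σ _).trans ?_)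
  exact ⟨Equiv.refl _, fun _ _ => Equiv.refl _, fun _ _ => rfl, fun _ _ => rfl, fun _ => rfl,
    fun i => congrArg G.inp (σ.apply_symm_apply i).symm, fun _ => rfl⟩

theorem MonogamousAcyclic.relabel {n n' m : ℕ} {G : Cospan Sig n m} (hG : G.MonogamousAcyclic)
    (σ : Fin n' ≃ Fin n) : (G.relabel σ _root_.id).MonogamousAcyclic :=
  ((monogamousAcyclic_wiring σ.symm.bijective).comp hG).of_iso (wiringComp σ.symm G)

/-! ### Recognition of a composite -/

/-- A cospan that is covered by two cospans overlapping exactly in their common interface is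
isomorphic to their composite. -/
noncomputable def compIsoOfCover {a b c : ℕ} {G : Cospan Sig a b} {H : Cospan Sig b c}
    {K : Cospan Sig a c} (p : G.Node → K.Node) (q : H.Node → K.Node)
    (hpq : ∀ i, p (G.out i) = q (H.inp i)) (hp : Function.Injective p) (hq : Function.Injective q)
    (hcover : ∀ v, (∃ x, p x = v) ∨ ∃ y, q y = v)
    (hmeet : ∀ x y, p x = q y → ∃ i, G.out i = x ∧ H.inp i = y)
    (e : ∀ k l, G.Edge k l ⊕ H.Edge k l ≃ K.Edge k l)
    (hsrcG : ∀ {k l} (x : G.Edge k l) i, K.src (e k l (.inl x)) i = p (G.src x i))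
    (hsrcH : ∀ {k l} (x : H.Edge k l) i, K.src (e k l (.inr x)) i = q (H.src x i))
    (htgtG : ∀ {k l} (x : G.Edge k l) i, K.tgt (e k l (.inl x)) i = p (G.tgt x i))
    (htgtH : ∀ {k l} (x : H.Edge k l) i, K.tgt (e k l (.inr x)) i = q (H.tgt x i))
    (hlabelG : ∀ {k l} (x : G.Edge k l), K.label (e k l (.inl x)) = G.label x)
    (hlabelH : ∀ {k l} (x : H.Edge k l), K.label (e k l (.inr x)) = H.label x)
    (hinp : ∀ i, K.inp i = p (G.inp i)) (hout : ∀ i, K.out i = q (H.out i)) :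
    Iso (G.comp H) K where
  node := Equiv.ofBijective
    (Quot.lift (Sum.elim p q) (by rintro _ _ ⟨i⟩; exact hpq i)) (by
      have hglue {x y} (h : p x = q y) : Quot.mk (Glue G H) (.inl x) = Quot.mk _ (.inr y) := by
        obtain ⟨i, rfl, rfl⟩ := hmeet x y h
        exact Quot.sound (.glue i)
      constructor
      · rintro ⟨x | y⟩ ⟨x' | y'⟩ h
        · exact congrArg (fun x => Quot.mk (Glue G H) (Sum.inl x)) (hp h)
        · exact hglue h
        · exact (hglue h.symm).symm
        · exact congrArg (fun x => Quot.mk (Glue G H) (Sum.inr x)) (hq h)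
      · intro v
        obtain ⟨x, rfl⟩ | ⟨y, rfl⟩ := hcover v
        exacts [⟨Quot.mk _ (.inl x), rfl⟩, ⟨Quot.mk _ (.inr y), rfl⟩])
  edge := e
  src := by rintro _ _ (x | x) i; exacts [hsrcG x i, hsrcH x i]
  tgt := by rintro _ _ (x | x) i; exacts [htgtG x i, htgtH x i]
  label := by rintro _ _ (x | x); exacts [hlabelG x, hlabelH x]
  inp := hinp
  out := hout

/-! ### Removal of a hyperedge whose sources are inputs -/

section Port

variable {n m : ℕ} {G : Cospan Sig n m}

theorem MonogamousAcyclic.inp_injective (hG : G.MonogamousAcyclic) :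
    Function.Injective G.inp := fun i j h =>
  Sum.inl_injective (hG.entry_bijective.1 (a₁ := .inl i) (a₂ := .inl j) h)

theorem MonogamousAcyclic.inp_ne_tgt (hG : G.MonogamousAcyclic) (i) {k l} (e : G.Edge k l) (j) :
    G.inp i ≠ G.tgt e j := fun h => by
  simpa using hG.entry_bijective.1 (a₁ := .inl i) (a₂ := .inr ⟨⟨k, l, e⟩, j⟩) h

theorem MonogamousAcyclic.out_ne_src (hG : G.MonogamousAcyclic) (i) {k l} (e : G.Edge k l) (j) :
    G.out i ≠ G.src e j := fun h => by
  simpa using hG.exit_bijective.1 (a₁ := .inl i) (a₂ := .inr ⟨⟨k, l, e⟩, j⟩) h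

theorem MonogamousAcyclic.tgt_injective (hG : G.MonogamousAcyclic) {k l k' l'} {e : G.Edge k l}
    {j} {e' : G.Edge k' l'} {j'} (h : G.tgt e j = G.tgt e' j') :
    (⟨⟨k, l, e⟩, j⟩ : Σ h : G.AnyEdge, Fin h.2.1) = ⟨⟨k', l', e'⟩, j'⟩ :=
  Sum.inr_injective (hG.entry_bijective.1 (a₁ := .inr ⟨⟨k, l, e⟩, j⟩)
    (a₂ := .inr ⟨⟨k', l', e'⟩, j'⟩) h)

theorem MonogamousAcyclic.src_injective (hG : G.MonogamousAcyclic) {k l k' l'} {e : G.Edge k l}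
    {j} {e' : G.Edge k' l'} {j'} (h : G.src e j = G.src e' j') :
    (⟨⟨k, l, e⟩, j⟩ : Σ h : G.AnyEdge, Fin h.1) = ⟨⟨k', l', e'⟩, j'⟩ :=
  Sum.inr_injective (hG.exit_bijective.1 (a₁ := .inr ⟨⟨k, l, e⟩, j⟩)
    (a₂ := .inr ⟨⟨k', l', e'⟩, j'⟩) h)

/-- A monogamous cospan has finitely many hyperedges in total: all arities and coarities are
bounded by the number of nodes. -/
theorem MonogamousAcyclic.finite_anyEdge (hG : G.MonogamousAcyclic) : Finite G.AnyEdge := by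
  have := G.node_finite
  have := G.edge_finite
  let N := Nat.card G.Node
  have hk {k l} (e : G.Edge k l) : k < N + 1 := by
    have := Nat.card_le_card_of_injective (G.src e) fun i j h => by
      simpa using hG.src_injective h
    simp only [Nat.card_eq_fintype_card, Fintype.card_fin] at this
    exact Nat.lt_succ_of_le this
  have hl {k l} (e : G.Edge k l) : l < N + 1 := by
    have := Nat.card_le_card_of_injective (G.tgt e) fun i j h => by
      simpa using hG.tgt_injective h
    simp only [Nat.card_eq_fintype_card, Fintype.card_fin] at this
    exact Nat.lt_succ_of_le this
  refine Finite.of_surjective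
    (fun p : Σ k : Fin (N + 1), Σ l : Fin (N + 1), G.Edge k l => (⟨p.1, p.2.1, p.2.2⟩ : G.AnyEdge)) ?_
  rintro ⟨k, l, e⟩
  exact ⟨⟨⟨k, hk e⟩, ⟨l, hl e⟩, e⟩, rfl⟩

/-- Some hyperedge of an acyclic cospan has only inputs as sources. -/
theorem MonogamousAcyclic.exists_initial_edge (hG : G.MonogamousAcyclic) [Nonempty G.AnyEdge] :
    ∃ h : G.AnyEdge, ∀ j, G.src h.2.2 j ∈ Set.range G.inp := by
  obtain ⟨ρ, hρ⟩ := hG.exists_rank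
  -- `r h` is one more than the largest rank of a source of `h`, and `0` if there is none. If a
  -- source of a minimal `h` were a target of `e`, all sources of `e` would have smaller rank than
  -- it, so that `r e < r h`.
  let r : G.AnyEdge → ℕ := fun h => Finset.univ.sup fun j => ρ (G.src h.2.2 j) + 1
  obtain ⟨h, hh⟩ : ∃ h, ∀ h', r h ≤ r h' :=
    ⟨Function.argmin r, fun h' => Function.argmin_le r h'⟩
  refine ⟨h, fun j => ?_⟩
  obtain ⟨i | ⟨⟨k, l, e⟩, i⟩, hi⟩ := hG.entry_bijective.2 (G.src h.2.2 j)
  · exact ⟨i, hi⟩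
  · exfalso
    refine (hh ⟨k, l, e⟩).not_gt (lt_of_le_of_lt (b := ρ (G.src h.2.2 j)) ?_ ?_)
    · refine Finset.sup_le fun i' _ => ?_
      rw [← hi]
      exact hρ e i' i
    · exact Finset.le_sup (f := fun j => ρ (G.src h.2.2 j) + 1) (Finset.mem_univ j)

end Port

variable {k l r m : ℕ}

/-- Remove from a cospan a hyperedge whose sources are the first inputs: its targets become the
first inputs. -/
def removeEdge (G : Cospan Sig (k + r) m) (hG : G.MonogamousAcyclic) (e₀ : G.Edge k l)
    (h₀ : ∀ j, G.src e₀ j = G.inp (Fin.castAdd r j)) : Cospan Sig (l + r) m where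
  Node := {v : G.Node // v ∉ Set.range (G.src e₀)}
  Edge k' l' := {e : G.Edge k' l' // (⟨k', l', e⟩ : G.AnyEdge) ≠ ⟨k, l, e₀⟩}
  src e j := ⟨G.src e.1 j, by
    rintro ⟨i, hi⟩
    exact e.2 (congrArg Sigma.fst (hG.src_injective hi)).symm⟩
  tgt e j := ⟨G.tgt e.1 j, by
    rintro ⟨i, hi⟩
    exact hG.inp_ne_tgt _ _ _ ((h₀ i).symm.trans hi)⟩
  label e := G.label e.1
  node_finite := by have := G.node_finite; infer_instance
  edge_finite k l := by have := G.edge_finite k l; infer_instance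
  inp := Fin.append
    (fun j => ⟨G.tgt e₀ j, by
      rintro ⟨i, hi⟩
      exact hG.inp_ne_tgt _ _ _ ((h₀ i).symm.trans hi)⟩)
    (fun j => ⟨G.inp (Fin.natAdd k j), by
      rintro ⟨i, hi⟩
      have := congrArg Fin.val (hG.inp_injective ((h₀ i).symm.trans hi))
      simp only [Fin.val_castAdd, Fin.val_natAdd] at this
      omega⟩)
  out i := ⟨G.out i, by
    rintro ⟨j, hj⟩
    exact hG.out_ne_src _ _ _ hj.symm⟩

section Remove

variable {G : Cospan Sig (k + r) m} (hG : G.MonogamousAcyclic) (e₀ : G.Edge k l)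
  (h₀ : ∀ j, G.src e₀ j = G.inp (Fin.castAdd r j))

theorem removeEdge_inp_castAdd (j : Fin l) :
    ((G.removeEdge hG e₀ h₀).inp (Fin.castAdd r j)).1 = G.tgt e₀ j := by
  simp [removeEdge]

theorem removeEdge_inp_natAdd (j : Fin r) :
    ((G.removeEdge hG e₀ h₀).inp (Fin.natAdd l j)).1 = G.inp (Fin.natAdd k j) := by
  simp [removeEdge]

/-- The sources of `e₀` disappear together with the inputs where they began and the hyperedge where
they ended. The targets of `e₀` now begin at the new inputs; all other beginnings and ends persist,
and the rank restricts. -/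
theorem monogamousAcyclic_removeEdge : (G.removeEdge hG e₀ h₀).MonogamousAcyclic := by
  refine ⟨⟨?_, ?_⟩, ⟨?_, ?_⟩, ?_⟩
  · have hne (e : (G.removeEdge hG e₀ h₀).AnyEdge) (i) (j) :
        G.tgt e.2.2.1 i ≠ G.tgt e₀ j := fun h =>
      e.2.2.2 (congrArg Sigma.fst (hG.tgt_injective h))
    refine Function.Injective.sumElim ?_ ?_ ?_
    · intro i j h
      have h := congrArg Subtype.val h
      induction i using Fin.addCases with
      | left i =>
        induction j using Fin.addCases with
        | left j =>
          rw [removeEdge_inp_castAdd, removeEdge_inp_castAdd] at h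
          have := hG.tgt_injective h
          simp only [Sigma.mk.injEq, heq_eq_eq, true_and] at this
          rw [this]
        | right j =>
          rw [removeEdge_inp_castAdd, removeEdge_inp_natAdd] at h
          exact (hG.inp_ne_tgt _ _ _ h.symm).elim
      | right i =>
        induction j using Fin.addCases with
        | left j =>
          rw [removeEdge_inp_castAdd, removeEdge_inp_natAdd] at h
          exact (hG.inp_ne_tgt _ _ _ h).elim
        | right j =>
          rw [removeEdge_inp_natAdd, removeEdge_inp_natAdd] at h
          have := congrArg Fin.val (hG.inp_injective h)
          simp only [Fin.val_natAdd] at this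
          exact Fin.ext (by simp only [Fin.val_natAdd]; omega)
    · rintro ⟨⟨k, l, e, he⟩, i⟩ ⟨⟨k', l', e', he'⟩, i'⟩ h
      have := hG.tgt_injective (congrArg Subtype.val h)
      cases this
      rfl
    · rintro i ⟨e, j⟩ h
      have h := congrArg Subtype.val h
      induction i using Fin.addCases with
      | left i =>
        rw [removeEdge_inp_castAdd] at h
        exact hne _ _ _ h.symm
      | right i =>
        rw [removeEdge_inp_natAdd] at h
        exact hG.inp_ne_tgt _ _ _ h
  · rintro ⟨v, hv⟩
    obtain ⟨i | ⟨⟨k', l', e⟩, i⟩, rfl⟩ := hG.entry_bijective.2 v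
    · induction i using Fin.addCases with
      | left i => exact (hv ⟨i, h₀ i⟩).elim
      | right i => exact ⟨.inl (Fin.natAdd l i), Subtype.ext (removeEdge_inp_natAdd hG e₀ h₀ i)⟩
    · by_cases he : (⟨k', l', e⟩ : G.AnyEdge) = ⟨k, l, e₀⟩
      · cases he
        exact ⟨.inl (Fin.castAdd r i), Subtype.ext (removeEdge_inp_castAdd hG e₀ h₀ i)⟩
      · exact ⟨.inr ⟨⟨k', l', e, he⟩, i⟩, rfl⟩
  · rintro (i | ⟨⟨k, l, e, he⟩, i⟩) (j | ⟨⟨k', l', e', he'⟩, j⟩) h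
    · have h : G.out i = G.out j := congrArg Subtype.val h
      exact congrArg Sum.inl
        (Sum.inl_injective (hG.exit_bijective.1 (a₁ := .inl i) (a₂ := .inl j) h))
    · exact (hG.out_ne_src _ _ _ (congrArg Subtype.val h)).elim
    · exact (hG.out_ne_src _ _ _ (congrArg Subtype.val h).symm).elim
    · have := hG.src_injective (congrArg Subtype.val h)
      cases this
      rfl
  · rintro ⟨v, hv⟩
    obtain ⟨i | ⟨⟨k', l', e⟩, i⟩, rfl⟩ := hG.exit_bijective.2 v
    · exact ⟨.inl i, rfl⟩
    · by_cases he : (⟨k', l', e⟩ : G.AnyEdge) = ⟨k, l, e₀⟩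
      · cases he
        exact (hv ⟨i, rfl⟩).elim
      · exact ⟨.inr ⟨⟨k', l', e, he⟩, i⟩, rfl⟩
  · obtain ⟨ρ, hρ⟩ := hG.exists_rank
    exact ⟨fun v => ρ v.1, fun e i j => hρ e.1 i j⟩

theorem card_anyEdge_removeEdge_lt :
    Nat.card (G.removeEdge hG e₀ h₀).AnyEdge < Nat.card G.AnyEdge := by
  -- Finiteness is essential here: `Nat.card` of an infinite type is `0`.
  have := hG.finite_anyEdge
  refine lt_of_le_of_lt ?_ (Finite.card_subtype_lt
    (p := fun h : G.AnyEdge => h ≠ ⟨k, l, e₀⟩) (x := ⟨k, l, e₀⟩) (by simp))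
  refine Nat.card_le_card_of_injective
    (fun h => ⟨⟨h.1, h.2.1, h.2.2.1⟩, h.2.2.2⟩) ?_
  rintro ⟨k, l, e, he⟩ ⟨k', l', e', he'⟩ h
  cases congrArg Subtype.val h
  rfl

/-- The hyperedges of a cospan are the removed one and the others. -/
noncomputable def removeEdgeEquiv (k' l' : ℕ) :
    ((gen (G.label e₀)).tensor (id Sig r)).Edge k' l' ⊕ (G.removeEdge hG e₀ h₀).Edge k' l' ≃
      G.Edge k' l' :=
  Equiv.ofBijective
    (Sum.elim (Sum.elim (fun x => castHom x.2.1.symm x.2.2.symm e₀) Empty.elim) Subtype.val) (by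
      constructor
      · rintro ((⟨⟨⟩, rfl, rfl⟩ | ⟨⟨⟩⟩) | ⟨x, hx⟩) ((⟨⟨⟩, h1, h2⟩ | ⟨⟨⟩⟩) | ⟨y, hy⟩) h
        · rfl
        · exact (hy (congrArg (fun x => (⟨k', l', x⟩ : G.AnyEdge)) h.symm)).elim
        · subst h1 h2
          exact (hx (congrArg (fun x => (⟨k', l', x⟩ : G.AnyEdge)) h)).elim
        · exact congrArg Sum.inr (Subtype.ext h)
      · intro x
        by_cases hx : (⟨k', l', x⟩ : G.AnyEdge) = ⟨k, l, e₀⟩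
        · cases hx
          exact ⟨.inl (.inl ⟨(), rfl, rfl⟩), rfl⟩
        · exact ⟨.inr ⟨x, hx⟩, rfl⟩)

/-- A cospan is the composite of a hyperedge whose sources are the first inputs with what remains
after its removal. -/
noncomputable def removeEdgeIso :
    Iso (((gen (G.label e₀)).tensor (id Sig r)).comp (G.removeEdge hG e₀ h₀)) G :=
  compIsoOfCover (G := (gen (G.label e₀)).tensor (id Sig r))
    -- The nodes of the generator go to the sources and targets of `e₀`, and the identity wires to
    -- the remaining inputs. The image meets the retained nodes in the targets and these inputs,
    -- which are exactly the interface.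
    (Sum.elim (Sum.elim (G.src e₀) (G.tgt e₀)) (fun j => G.inp (Fin.natAdd k j)))
    Subtype.val
    (hpq := by
      intro i
      induction i using Fin.addCases with
      | left i => simp [removeEdge_inp_castAdd, tensor, gen]
      | right i => simp [removeEdge_inp_natAdd, tensor, id, wiring]; rfl)
    (hp := by
      refine Function.Injective.sumElim (Function.Injective.sumElim ?_ ?_ ?_) ?_ ?_
      · intro i j h
        simpa using hG.src_injective h
      · intro i j h
        simpa using hG.tgt_injective h
      · intro i j h
        exact hG.inp_ne_tgt _ _ _ ((h₀ i).symm.trans h)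
      · intro (i : Fin r) (j : Fin r) h
        have := congrArg Fin.val (hG.inp_injective h)
        simp only [Fin.val_natAdd] at this
        exact Fin.ext (by omega)
      · rintro (i | i) (j : Fin r) h
        · have := congrArg Fin.val (hG.inp_injective ((h₀ i).symm.trans h))
          simp only [Fin.val_castAdd, Fin.val_natAdd] at this
          omega
        · exact hG.inp_ne_tgt _ _ _ h.symm)
    (hq := Subtype.val_injective)
    (hcover := by
      intro v
      by_cases hv : v ∈ Set.range (G.src e₀)
      · obtain ⟨i, rfl⟩ := hv
        exact .inl ⟨.inl (.inl i), rfl⟩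
      · exact .inr ⟨⟨v, hv⟩, rfl⟩)
    (hmeet := by
      rintro ((i | i) | i) ⟨v, hv⟩ h
      · exact (hv ⟨i, h⟩).elim
      · exact ⟨Fin.castAdd r i, by simp [tensor, gen],
          Subtype.ext ((removeEdge_inp_castAdd hG e₀ h₀ i).trans h)⟩
      · exact ⟨Fin.natAdd l i,
          Fin.append_right (fun i => Sum.inl ((gen (G.label e₀)).out i)) Sum.inr (i : Fin r),
          Subtype.ext ((removeEdge_inp_natAdd hG e₀ h₀ i).trans h)⟩)
    (e := removeEdgeEquiv hG e₀ h₀)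
    (hsrcG := by rintro _ _ (⟨⟨⟩, rfl, rfl⟩ | ⟨⟨⟩⟩) i; rfl)
    (hsrcH := fun _ _ => rfl)
    (htgtG := by rintro _ _ (⟨⟨⟩, rfl, rfl⟩ | ⟨⟨⟩⟩) i; rfl)
    (htgtH := fun _ _ => rfl)
    (hlabelG := by rintro _ _ (⟨⟨⟩, rfl, rfl⟩ | ⟨⟨⟩⟩); rfl)
    (hlabelH := fun _ => rfl)
    (hinp := by
      intro i
      induction i using Fin.addCases with
      | left i => simp [tensor, gen, h₀]
      | right i => simp [tensor, id, wiring]; rfl)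
    (hout := fun _ => rfl)

end Remove

/-! ### Induction on the number of hyperedges -/

/-- Any enumeration of the complement of the range of `f` completes `f`. This supplies the
permutation that moves the sources of an initial hyperedge to the first inputs. -/
theorem exists_equiv_extending {n : ℕ} (f : Fin k → Fin n) (hf : Function.Injective f) :
    ∃ (r : ℕ) (σ : Fin (k + r) ≃ Fin n), ∀ j, σ (Fin.castAdd r j) = f j := by
  classical
  refine ⟨Nat.card ↥(Set.range f)ᶜ, finSumFinEquiv.symm.trans ((Equiv.sumCongr (Equiv.ofInjective f hf)
    (Finite.equivFin ↥(Set.range f)ᶜ).symm).trans (Equiv.Set.sumCompl _)), fun j => ?_⟩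
  rw [Equiv.trans_apply, finSumFinEquiv_symm_apply_castAdd]
  rfl

/-- A monogamous cospan without hyperedges is a permutation. -/
theorem MonogamousAcyclic.isDenoted_of_isEmpty {n : ℕ} {G : Cospan Sig n m}
    (hG : G.MonogamousAcyclic) [IsEmpty G.AnyEdge] : G.IsDenoted := by
  -- Without hyperedges, `entry` and `exit` reduce to the two legs, which are therefore bijections
  -- onto the nodes.
  let α := (Equiv.sumEmpty _ _).symm.trans (Equiv.ofBijective _ hG.entry_bijective)
  let β := (Equiv.sumEmpty _ _).symm.trans (Equiv.ofBijective _ hG.exit_bijective)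
  have hE (k l) : IsEmpty (G.Edge k l) := ⟨fun e => IsEmpty.false (⟨k, l, e⟩ : G.AnyEdge)⟩
  refine (isDenoted_wiring_equiv (β.trans α.symm)).of_iso
    ⟨α, fun k l => Equiv.equivOfIsEmpty Empty _, fun e => Empty.elim e,
      fun e => Empty.elim e, fun e => Empty.elim e, fun _ => rfl, fun i => ?_⟩
  exact (α.apply_symm_apply (β i)).symm

theorem MonogamousAcyclic.isDenoted {n : ℕ} {G : Cospan Sig n m} (hG : G.MonogamousAcyclic) :
    G.IsDenoted := by
  -- The arity `n` varies, since removal of a hyperedge `k → l` replaces `k` inputs by `l`.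
  induction h : Nat.card G.AnyEdge using Nat.strong_induction_on generalizing n with
  | _ N ih =>
    subst h
    cases isEmpty_or_nonempty G.AnyEdge
    · exact hG.isDenoted_of_isEmpty
    · obtain ⟨⟨k, l, e₀⟩, he₀⟩ := hG.exists_initial_edge
      choose f hf using he₀
      obtain ⟨r, σ, hσ⟩ := exists_equiv_extending f fun i j h => by
        have : G.src e₀ i = G.src e₀ j := (hf i).symm.trans ((congrArg G.inp h).trans (hf j))
        simpa using hG.src_injective this
      have h₀ : ∀ j, (G.relabel σ _root_.id).src e₀ j =
          (G.relabel σ _root_.id).inp (Fin.castAdd r j) := fun j =>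
        (hf j).symm.trans (congrArg G.inp (hσ j).symm)
      refine .of_relabel σ (.of_iso (removeEdgeIso (hG.relabel σ) e₀ h₀) ?_)
      exact ((isDenoted_gen _).tensor (isDenoted_id r)).comp
        (ih _ (card_anyEdge_removeEdge_lt (hG.relabel σ) e₀ h₀)
          (monogamousAcyclic_removeEdge (hG.relabel σ) e₀ h₀) rfl)

end Cospan

end FrobTerm

open FrobTerm in
/-- A cospan `n → G ← m` is (a representative of an arrow) in the image of the canonical PROP
morphism from the free PROP on `Sig` to Frobenius termgraphs iff it is monogamous and directed
acyclic. -/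
theorem theorem3p12 {Sig : ℕ → ℕ → Type u} {n m : ℕ} (G : Cospan Sig n m) :
    (Quotient.mk _ G : (FTerm Sig).Hom n m) ∈
        Set.range (fun d : (freePROP Sig).Hom n m => (interp Sig).map d) ↔
      G.Monogamous ∧ G.DirectedAcyclic := by
  rw [← Cospan.monogamousAcyclic_iff]
  constructor
  · rintro ⟨⟨t⟩, ht⟩
    obtain ⟨H, hH, h⟩ := exists_monogamousAcyclic_eval t
    -- The term denotes both `H` and `G`, so the two are isomorphic as cospans and the condition
    -- transfers.
    obtain ⟨f⟩ := Quotient.exact (h.symm.trans ht)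
    exact hH.of_iso f
  · intro hG
    obtain ⟨t, ht⟩ := hG.isDenoted
    exact ⟨Quot.mk _ t, ht⟩
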